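/- For positive integers $r,s$ let $w_r(s)=1$ if $s\mid r$ and $w_r(s)=0$ otherwise. For a group $G$ and a positive integer $m$ let $s_m(G)$ denote the number of conjugacy classes of subgroups of order $m$ in $G$. Let $p$ be a prime and let $G=\mathrm{GL}(2,p)$ be the group of invertible $2\times 2$ matrices over the field with $p$ elements. (a) If $p\neq 2$, then $s_2(G)=2$. For every prime $q>2$ with $q\neq p$, $$s_q(G)=\frac{q+3}{2}\,w_{p-1}(q)+w_{p+1}(q).$$ (b) If $p\neq 2$, then $s_4(G)=2+3\,w_{p-1}(4)$. For every prime $q>2$ with $q\neq p$, $$s_{q^2}(G)=w_{p-1}(q)+\frac{q^2+q+2}{2}\,w_{p-1}(q^2)+w_{p+1}(q^2).$$ (c) If $p\neq 2$, then for every prime $r\neq p$ with $r\neq 2$, $$s_{2r}(G)=\frac{3r+7}{2}\,w_{p-1}(r)+2\,w_{p+1}(r).$$ For all primes $q,r$ different from $p$ with $r>q>2$, $$s_{qr}(G)=\frac{qr+q+r+5}{2}\,w_{p-1}(qr)+w_{p^2-1}(qr)\bigl(1-w_{p-1}(qr)\bigr).$$ -/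

import Mathlib

/-- Conjugacy under `G` on the set of subgroups of `G` of order `m`. -/
def subgroupConjSetoid (G : Type*) [Group G] (m : ℕ) :
    Setoid {H : Subgroup G // Nat.card H = m} where
  r H K := ∃ g : G, (H : Subgroup G).map (MulAut.conj g).toMonoidHom = K
  iseqv :=
    { refl := fun H => ⟨1, by ext x; simp⟩
      symm := by
        rintro H K ⟨g, hg⟩
        refine ⟨g⁻¹, ?_⟩
        rw [← hg, Subgroup.map_map]
        ext x
        simp [Subgroup.mem_map, mul_assoc]
      trans := by
        rintro H K L ⟨g, hg⟩ ⟨k, hk⟩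
        refine ⟨k * g, ?_⟩
        rw [← hk, ← hg, Subgroup.map_map]
        ext x
        simp [Subgroup.mem_map, mul_assoc] }

/-- `s_m(G)`: the number of conjugacy classes of subgroups of order `m` in `G`. -/
noncomputable def numSubgroupClasses (m : ℕ) (G : Type*) [Group G] : ℕ :=
  Nat.card (Quotient (subgroupConjSetoid G m))

/-- `w_r(s) = 1` if `s` divides `r`, and `w_r(s) = 0` otherwise. -/
def divInd (r s : ℕ) : ℚ := if s ∣ r then 1 else 0

/-! Let `m` be prime to `p`. The conjugacy classes of subgroups of order `m` fall into three
disjoint kinds, counted separately (`numSubgroupClasses_eq_add`): abelian and conjugate into the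
diagonal torus (split), abelian but not split, and nonabelian.

Split classes. Put C = (ZMod p)ˣ. Two subgroups of the diagonal torus C × C are conjugate in GL₂
exactly when they are equal or exchanged by swapping the factors, so the number of classes is half
of (all subgroups of order m + swap-invariant ones). When the relevant divisibility by m holds,
cyclic subgroups are counted by dividing the number of elements of order m by φ(m), giving q + 1, q²
+ q for order q², and (q + 1)(r + 1); order q² also has the noncyclic q-torsion. Swap-invariant
cyclic subgroups are generated by (z, z ^ k) with z of order m and k² = 1 in Z/m, so they are
counted by square roots of one.

Nonsplit classes. An element of order prime to p is semisimple. In a nonsplit abelian subgroup some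
nonscalar element has an irreducible characteristic polynomial, and the subgroup lies in its
centralizer, a copy of the units of the field with p² elements. That group is cyclic, so a subgroup
of it is determined by its order: there is one class if m ∣ p² - 1 and m ∤ p - 1, and none otherwise
(`ncard_nonsplitClasses`).

Nonabelian classes. There are none of order q or q². In order qr with q < r the group of order r is
normal. An element normalizing a nonscalar h of order prime to p ≠ 2, with image commuting with h,
either fixes h or sends it to tr h - h. Applying this twice gives h, so an element of odd order must
fix h, and odd qr gives abelian groups. In order 2r the nonabelian subgroups are dihedral; a
dihedral pair is determined up to conjugacy by the trace of the rotation, and a power of the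
rotation can be chosen to match any other rotation, so there is one class, present exactly when r ∣
p² - 1 (`ncard_nonabelianClasses_two_mul`). -/

/-! ### Two counting principles: orbits of an involution, cyclic subgroups by their generators -/

theorem two_mul_ncard_range_of_involutive {S Q : Type*} [Finite S] (σ : S → S)
    (hσ : Function.Involutive σ) (f : S → Q) (hf : ∀ x y, f x = f y ↔ y = x ∨ y = σ x) :
    2 * (Set.range f).ncard = Nat.card S + {x | σ x = x}.ncard := by
  classical
  have := Fintype.ofFinite S
  have h1 : Nat.card S = ∑ c ∈ Finset.univ.image f, (Finset.univ.filter fun x => f x = c).card := by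
    rw [Nat.card_eq_fintype_card, ← Finset.card_univ]
    exact Finset.card_eq_sum_card_image f _
  have h2 : {x | σ x = x}.ncard =
      ∑ c ∈ Finset.univ.image f, (Finset.univ.filter fun x => σ x = x ∧ f x = c).card := by
    rw [Set.ncard_eq_toFinset_card', Finset.card_eq_sum_card_fiberwise
      (t := Finset.univ.image f) (f := f) (fun x _ => by simp)]
    refine Finset.sum_congr rfl fun c _ => ?_
    congr 1
    ext x
    simp
  have h3 : (Set.range f).ncard = (Finset.univ.image f).card := by
    rw [← Set.ncard_coe_finset]; simp
  rw [h1, h2, h3, ← Finset.sum_add_distrib, mul_comm, ← smul_eq_mul, ← Finset.sum_const]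
  refine Finset.sum_congr rfl fun c hc => ?_
  obtain ⟨x, -, rfl⟩ := Finset.mem_image.1 hc
  -- Each fibre is one orbit {x, σ x}: either two points and no fixed point, or one point that is
  -- fixed. Its size plus its number of fixed points is 2 both times.
  have e1 : (Finset.univ.filter fun y => f y = f x) = {x, σ x} := by
    ext y
    simp only [Finset.mem_filter, Finset.mem_univ, true_and, Finset.mem_insert,
      Finset.mem_singleton]
    rw [← hf x y, eq_comm]
  by_cases hx : σ x = x
  · have e2 : (Finset.univ.filter fun y => σ y = y ∧ f y = f x) = {x} := by
      ext y
      have := hf x y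
      rw [hx] at this
      simp only [Finset.mem_filter, Finset.mem_univ, true_and, Finset.mem_singleton]
      constructor
      · rintro ⟨-, h⟩
        simpa using this.1 h.symm
      · rintro rfl
        exact ⟨hx, rfl⟩
    rw [e1, e2, hx]
    simp
  · have e2 : (Finset.univ.filter fun y => σ y = y ∧ f y = f x) = ∅ := by
      ext y
      simp only [Finset.mem_filter, Finset.mem_univ, true_and, Finset.notMem_empty, iff_false]
      rintro ⟨h, h'⟩
      rcases (hf x y).1 h'.symm with rfl | rfl
      · exact hx h
      · rw [hσ x] at h
        exact hx h.symm
    rw [e1, e2, Finset.card_pair (Ne.symm hx)]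
    simp

/-- Sending x to the pair (group generated by x, x) is a bijection from elements of order n to
cyclic subgroups of order n with a chosen generator, and each such subgroup has φ(n) generators. -/
theorem card_orderOf_eq_totient_mul_card_cyclic (A : Type*) [Group A] [Finite A] (n : ℕ) :
    {x : A | orderOf x = n}.ncard =
      n.totient * {B : Subgroup A | Nat.card B = n ∧ IsCyclic B}.ncard := by
  classical
  have := Fintype.ofFinite A
  let e : {x : A | orderOf x = n} ≃
      Σ B : {B : Subgroup A | Nat.card B = n ∧ IsCyclic B}, {y : B.1 | orderOf y = n} :=
    { toFun := fun x => ⟨⟨Subgroup.zpowers x.1, by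
          rw [Set.mem_ofPred_eq, Nat.card_zpowers]; exact ⟨x.2, inferInstance⟩⟩,
          ⟨⟨x.1, Subgroup.mem_zpowers _⟩, by
            rw [Set.mem_ofPred_eq, Subgroup.orderOf_mk]; exact x.2⟩⟩
      invFun := fun y => ⟨y.2.1.1, by
        have := y.2.2
        rw [Set.mem_ofPred_eq] at this ⊢
        rwa [Subgroup.orderOf_coe]⟩
      left_inv := fun x => rfl
      right_inv := by
        rintro ⟨⟨B, hB, hc⟩, ⟨⟨y, hy⟩, hy'⟩⟩
        have hle : Subgroup.zpowers y ≤ B := by simpa using hy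
        have heq : Subgroup.zpowers y = B := by
          apply Subgroup.eq_of_le_of_card_ge hle
          rw [Nat.card_zpowers, hB]
          rw [Set.mem_ofPred_eq, Subgroup.orderOf_mk] at hy'
          exact hy'.ge
        subst heq
        rfl }
  have := Fintype.ofFinite {B : Subgroup A | Nat.card B = n ∧ IsCyclic B}
  rw [← Nat.card_coe_set_eq, Nat.card_congr e, Nat.card_sigma, ← Nat.card_coe_set_eq,
    Finset.sum_congr rfl (g := fun _ => n.totient)]
  · rw [Finset.sum_const, smul_eq_mul, Finset.card_univ, Nat.card_eq_fintype_card, mul_comm]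
  · rintro ⟨B, hB, hc⟩ -
    rw [← IsCyclic.card_orderOf_eq_totient (α := B) (d := n)
      (by rw [← Nat.card_eq_fintype_card, hB]), Nat.card_coe_set_eq,
      Set.ncard_eq_toFinset_card']
    congr 1
    ext x
    simp

/-! ### Subgroups of C × C for a finite cyclic group C -/

/-- The image of a subgroup of `C × C` under the exchange of the two factors. -/
def Subgroup.swapProd {C : Type*} [CommGroup C] (B : Subgroup (C × C)) : Subgroup (C × C) :=
  B.map (MulEquiv.prodComm : C × C ≃* C × C).toMonoidHom

theorem Subgroup.mem_swapProd {C : Type*} [CommGroup C] {B : Subgroup (C × C)} {x : C × C} :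
    x ∈ B.swapProd ↔ x.swap ∈ B := by
  rw [swapProd, Subgroup.mem_map]
  constructor
  · rintro ⟨y, hy, rfl⟩; exact hy
  · intro h; exact ⟨x.swap, h, rfl⟩

theorem Subgroup.card_swapProd {C : Type*} [CommGroup C] (B : Subgroup (C × C)) : Nat.card B.swapProd = Nat.card B :=
  Subgroup.card_map_of_injective (MulEquiv.injective _)

/-- H is killed by its own order d, and in a finite cyclic group only gcd(|C|, d) = d elements are
killed by d, so the inclusion is an equality. -/
theorem IsCyclic.subgroup_eq_ker_powMonoidHom {C : Type*} [CommGroup C] [IsCyclic C] [Finite C]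
    (H : Subgroup C) : H = (powMonoidHom (Nat.card H) : C →* C).ker := by
  apply Subgroup.eq_of_le_of_card_ge
  · intro x hx
    rw [MonoidHom.mem_ker, powMonoidHom_apply]
    have := pow_card_eq_one' (x := (⟨x, hx⟩ : H))
    exact congrArg Subtype.val this
  · rw [IsCyclic.card_powMonoidHom_ker, Nat.gcd_eq_right H.card_subgroup_dvd_card]

theorem IsCyclic.subgroup_eq_of_card_eq {C : Type*} [CommGroup C] [IsCyclic C] [Finite C]
    {H K : Subgroup C} (h : Nat.card H = Nat.card K) : H = K := by
  rw [subgroup_eq_ker_powMonoidHom H, subgroup_eq_ker_powMonoidHom K, h]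

theorem IsCyclic.exists_orderOf_eq {C : Type*} [Group C] [IsCyclic C] [Finite C] {n : ℕ}
    (h : n ∣ Nat.card C) : ∃ z : C, orderOf z = n := by
  obtain ⟨g, hg⟩ := IsCyclic.exists_ofOrder_eq_natCard (α := C)
  obtain ⟨d, hd⟩ := h
  refine ⟨g ^ d, ?_⟩
  have hd0 : d ≠ 0 := by
    rintro rfl
    exact Nat.card_pos.ne' (by simpa using hd)
  rw [orderOf_pow' _ hd0, hg, hd, Nat.gcd_eq_right (Dvd.intro_left _ rfl)]
  exact Nat.mul_div_cancel _ (Nat.pos_of_ne_zero hd0)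

section CyclicSquare

variable {C : Type*} [CommGroup C] [IsCyclic C] [Finite C]

theorem ncard_prod_pow_eq_one (n : ℕ) :
    {x : C × C | x ^ n = 1}.ncard = (Nat.card C).gcd n ^ 2 := by
  have : {x : C × C | x ^ n = 1} = {c : C | c ^ n = 1} ×ˢ {c : C | c ^ n = 1} := by
    ext ⟨a, b⟩
    simp [Prod.ext_iff]
  rw [this, Set.ncard_prod, sq]
  have h : {c : C | c ^ n = 1}.ncard = (Nat.card C).gcd n := by
    rw [← IsCyclic.card_powMonoidHom_ker, ← Nat.card_coe_set_eq]
    rfl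
  rw [h]

theorem ncard_prod_orderOf_prime {q : ℕ} (hq : q.Prime) (h : q ∣ Nat.card C) :
    {x : C × C | orderOf x = q}.ncard = q ^ 2 - 1 := by
  have : {x : C × C | orderOf x = q} = {x : C × C | x ^ q = 1} \ {1} := by
    ext x
    simp only [Set.mem_ofPred_eq, Set.mem_sdiff, Set.mem_singleton_iff]
    rw [← orderOf_dvd_iff_pow_eq_one, Nat.dvd_prime hq, ← orderOf_eq_one_iff (x := x)]
    have := hq.one_lt
    constructor
    · intro h
      exact ⟨Or.inr h, by omega⟩
    · rintro ⟨h1, h2⟩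
      exact h1.resolve_left h2
  rw [this, Set.ncard_sdiff (by simp), ncard_prod_pow_eq_one, Nat.gcd_eq_right h]
  simp

theorem ncard_prod_orderOf_prime_sq {q : ℕ} (hq : q.Prime) (h : q ^ 2 ∣ Nat.card C) :
    {x : C × C | orderOf x = q ^ 2}.ncard = q ^ 4 - q ^ 2 := by
  have : {x : C × C | orderOf x = q ^ 2} = {x : C × C | x ^ (q ^ 2) = 1} \ {x | x ^ q = 1} := by
    ext x
    simp only [Set.mem_ofPred_eq, Set.mem_sdiff]
    constructor
    · intro h
      rw [← orderOf_dvd_iff_pow_eq_one, ← orderOf_dvd_iff_pow_eq_one, h]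
      refine ⟨dvd_rfl, fun h => ?_⟩
      have := Nat.le_of_dvd hq.pos h
      have := hq.one_lt
      nlinarith
    · rintro ⟨h1, h2⟩
      have := Fact.mk hq
      simpa using orderOf_eq_prime_pow (p := q) (n := 1) (x := x) (by simpa using h2)
        (by simpa using h1)
  rw [this, Set.ncard_sdiff, ncard_prod_pow_eq_one, ncard_prod_pow_eq_one, Nat.gcd_eq_right h,
    Nat.gcd_eq_right ((dvd_pow_self q two_ne_zero).trans h)]
  · ring_nf
  · intro x (hx : x ^ q = 1)
    simp [sq, pow_mul, hx]

theorem ncard_prod_orderOf_prime_mul {q r : ℕ} (hq : q.Prime) (hr : r.Prime) (hqr : q ≠ r)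
    (h : q * r ∣ Nat.card C) :
    {x : C × C | orderOf x = q * r}.ncard = (q ^ 2 - 1) * (r ^ 2 - 1) := by
  have hcop : q.Coprime r := (Nat.coprime_primes hq hr).2 hqr
  have e : {x : C × C | orderOf x = q * r} =
      {x : C × C | x ^ (q * r) = 1} \ ({x | x ^ q = 1} ∪ {x | x ^ r = 1}) := by
    ext x
    simp only [Set.mem_ofPred_eq, Set.mem_sdiff, Set.mem_union, ← orderOf_dvd_iff_pow_eq_one]
    constructor
    · intro h
      rw [h]
      refine ⟨dvd_rfl, ?_⟩
      have := hq.one_lt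
      have := hr.one_lt
      rintro (h | h)
      · have := Nat.le_of_dvd hq.pos h
        nlinarith
      · have := Nat.le_of_dvd hr.pos h
        nlinarith
    · rintro ⟨h1, h2⟩
      obtain ⟨a, b, ha, hb, hab⟩ := (Nat.dvd_mul).1 h1
      rcases (Nat.dvd_prime hq).1 ha with rfl | rfl <;> rcases (Nat.dvd_prime hr).1 hb with rfl | rfl
      · exact absurd (Or.inl (by rw [← hab]; simp)) h2
      · exact absurd (Or.inr (by rw [← hab]; simp)) h2
      · exact absurd (Or.inl (by rw [← hab]; simp)) h2
      · exact hab.symm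
  have hi : {x : C × C | x ^ q = 1} ∩ {x | x ^ r = 1} = {1} := by
    ext x
    simp only [Set.mem_inter_iff, Set.mem_ofPred_eq, Set.mem_singleton_iff,
      ← orderOf_dvd_iff_pow_eq_one]
    constructor
    · rintro ⟨h1, h2⟩
      have := Nat.dvd_gcd h1 h2
      rw [hcop.gcd_eq_one] at this
      exact orderOf_eq_one_iff.1 (Nat.dvd_one.1 this)
    · rintro rfl; simp
  have hu := Set.ncard_union_add_ncard_inter {x : C × C | x ^ q = 1} {x | x ^ r = 1}
  rw [hi, Set.ncard_singleton, ncard_prod_pow_eq_one, ncard_prod_pow_eq_one,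
    Nat.gcd_eq_right ((Dvd.intro _ rfl).trans h), Nat.gcd_eq_right ((Dvd.intro_left _ rfl).trans h)]
    at hu
  rw [e, Set.ncard_sdiff, ncard_prod_pow_eq_one, Nat.gcd_eq_right h]
  · have h1 : 1 ≤ q ^ 2 := Nat.one_le_pow _ _ hq.pos
    have h2 : 1 ≤ r ^ 2 := Nat.one_le_pow _ _ hr.pos
    generalize ({x : C × C | x ^ q = 1} ∪ {x | x ^ r = 1}).ncard = u at hu ⊢
    obtain ⟨a, ha⟩ := Nat.exists_eq_add_of_le h1
    obtain ⟨b, hb⟩ := Nat.exists_eq_add_of_le h2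
    rw [mul_pow, ha, hb]
    rw [ha, hb] at hu
    have : u = 1 + a + b := by omega
    subst this
    simp only [add_tsub_cancel_left]
    have : (1 + a) * (1 + b) = 1 + a + b + a * b := by ring
    omega
  · rintro x (hx | hx)
    · rw [Set.mem_ofPred_eq] at hx ⊢
      rw [pow_mul, hx, one_pow]
    · rw [Set.mem_ofPred_eq] at hx ⊢
      rw [mul_comm, pow_mul, hx, one_pow]

/-- If (a, b) generates a swap-invariant group, then (b, a) = (a, b) ^ j, so b = a ^ j and a = b ^
j. Hence a has order n and j² = 1 in `ZMod n`. Changing the generator so that its first coordinate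
is a fixed z of order n makes it (z, z ^ j), and the class of j is then determined by the group. -/
theorem ncard_cyclic_swap_fixed {n : ℕ} [NeZero n] (h : n ∣ Nat.card C) :
    {B : Subgroup (C × C) | (Nat.card B = n ∧ IsCyclic B) ∧ B.swapProd = B}.ncard =
      {k : ZMod n | k ^ 2 = 1}.ncard := by
  obtain ⟨z, hz⟩ := IsCyclic.exists_orderOf_eq h
  have hzm : ∀ a : C, orderOf a = n → z ∈ Subgroup.zpowers a := by
    intro a ha
    have : Subgroup.zpowers a = Subgroup.zpowers z := by
      apply IsCyclic.subgroup_eq_of_card_eq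
      rw [Nat.card_zpowers, Nat.card_zpowers, ha, hz]
    rw [this]
    exact Subgroup.mem_zpowers z
  have hzpow : ∀ i j : ℤ, z ^ i = z ^ j ↔ (i : ZMod n) = j := by
    intro i j
    rw [zpow_eq_zpow_iff_modEq, hz, ZMod.intCast_eq_intCast_iff]
  have hord : ∀ i : ℤ, orderOf ((z, z ^ i) : C × C) = n := by
    intro i
    rw [Prod.orderOf_mk, hz]
    apply Nat.lcm_eq_left
    rw [← hz]
    exact orderOf_dvd_of_mem_zpowers ⟨i, rfl⟩
  symm
  refine Set.ncard_congr (fun k _ => Subgroup.zpowers ((z, z ^ (k.val : ℤ)) : C × C)) ?_ ?_ ?_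
  · intro k hk
    refine ⟨⟨by rw [Nat.card_zpowers, hord], inferInstance⟩, ?_⟩
    symm
    apply Subgroup.eq_of_le_of_card_ge _ (Subgroup.card_swapProd _).le
    rw [Subgroup.zpowers_le, Subgroup.mem_swapProd]
    refine ⟨k.val, ?_⟩
    ext
    · rfl
    · change (z ^ (k.val : ℤ)) ^ (k.val : ℤ) = z
      conv_rhs => rw [← zpow_one z]
      rw [← zpow_mul, hzpow]
      have : k ^ 2 = 1 := hk
      push_cast
      rw [ZMod.natCast_zmod_val, ← sq, this]
  · intro k l hk hl hkl
    have hm : ((z, z ^ (l.val : ℤ)) : C × C) ∈ Subgroup.zpowers ((z, z ^ (k.val : ℤ)) : C × C) := by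
      rw [hkl]; exact Subgroup.mem_zpowers _
    obtain ⟨j, hj⟩ := hm
    have h1 : z ^ j = z ^ (1 : ℤ) := by simpa using congrArg Prod.fst hj
    have h2 : (z ^ (k.val : ℤ)) ^ j = z ^ (l.val : ℤ) := congrArg Prod.snd hj
    rw [← zpow_mul, hzpow] at h2
    rw [hzpow] at h1
    push_cast at h1 h2
    rw [h1, ZMod.natCast_zmod_val, ZMod.natCast_zmod_val, mul_one] at h2
    exact h2
  · rintro B ⟨⟨hB, hc⟩, hs⟩
    obtain ⟨⟨a, b⟩, hab⟩ := Subgroup.isCyclic_iff_exists_zpowers_eq_top B |>.1 hc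
    have hmem : ((b, a) : C × C) ∈ Subgroup.zpowers ((a, b) : C × C) := by
      rw [hab, ← hs, Subgroup.mem_swapProd, ← hab]
      exact Subgroup.mem_zpowers _
    obtain ⟨j, hj⟩ := hmem
    have h1 : a ^ j = b := congrArg Prod.fst hj
    have h2 : b ^ j = a := congrArg Prod.snd hj
    -- The order of (a, b) is the lcm of the two orders, and b is a power of a.
    have hoa : orderOf a = n := by
      rw [← hB, ← hab, Nat.card_zpowers, Prod.orderOf_mk]
      symm
      apply Nat.lcm_eq_left
      exact orderOf_dvd_of_mem_zpowers ⟨j, h1⟩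
    obtain ⟨i, hi⟩ := hzm a hoa
    dsimp only at hi
    refine ⟨(j : ZMod n), ?_, ?_⟩
    · have : a ^ (j * j) = a ^ (1 : ℤ) := by rw [zpow_mul, h1, h2, zpow_one]
      rw [zpow_eq_zpow_iff_modEq, hoa, ← ZMod.intCast_eq_intCast_iff] at this
      push_cast at this
      rw [Set.mem_ofPred_eq, sq, this]
    · apply Subgroup.eq_of_le_of_card_ge
      · rw [Subgroup.zpowers_le, ← hab]
        refine ⟨i, ?_⟩
        ext
        · exact hi
        · change b ^ i = z ^ ((j : ZMod n).val : ℤ)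
          have : z ^ ((j : ZMod n).val : ℤ) = z ^ j := by
            rw [hzpow]; push_cast; rw [ZMod.natCast_zmod_val]
          rw [this, ← h1, ← hi, ← zpow_mul, ← zpow_mul, mul_comm]
      · rw [hB, Nat.card_zpowers, hord]

end CyclicSquare

/-! ### Square roots of one in Z/n -/

theorem ncard_sq_eq_one_of_prime {q : ℕ} (hq : q.Prime) (h2 : q ≠ 2) :
    {k : ZMod q | k ^ 2 = 1}.ncard = 2 := by
  have := Fact.mk hq
  have : {k : ZMod q | k ^ 2 = 1} = {1, -1} := by
    ext k
    simp [sq_eq_one_iff]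
  rw [this, Set.ncard_pair]
  have : Fact (2 < q) := ⟨lt_of_le_of_ne hq.two_le (Ne.symm h2)⟩
  exact ZMod.neg_one_ne_one.symm

theorem ncard_sq_eq_one_of_prime_sq {q : ℕ} (hq : q.Prime) (h2 : q ≠ 2) :
    {k : ZMod (q ^ 2) | k ^ 2 = 1}.ncard = 2 := by
  have h3 : 2 < q := lt_of_le_of_ne hq.two_le (Ne.symm h2)
  have : {k : ZMod (q ^ 2) | k ^ 2 = 1} = {1, -1} := by
    ext k
    simp only [Set.mem_ofPred_eq, Set.mem_insert_iff, Set.mem_singleton_iff]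
    constructor
    · intro hk
      obtain ⟨i, rfl⟩ := ZMod.intCast_surjective k
      have hd : ((q : ℤ) ^ 2) ∣ (i - 1) * (i + 1) := by
        have : (((i - 1) * (i + 1) : ℤ) : ZMod (q ^ 2)) = 0 := by
          push_cast
          linear_combination hk
        rw [ZMod.intCast_zmod_eq_zero_iff_dvd] at this
        exact_mod_cast this
      have hp : Prime (q : ℤ) := Nat.prime_iff_prime_int.1 hq
      have key : ∀ j : ℤ, ((q : ℤ) ^ 2) ∣ j → ((j : ℤ) : ZMod (q ^ 2)) = 0 := by
        intro j hj
        rw [ZMod.intCast_zmod_eq_zero_iff_dvd]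
        exact_mod_cast hj
      -- The odd prime q cannot divide both i - 1 and i + 1, which differ by 2, so all of q² divides
      -- one of them.
      by_cases hq1 : (q : ℤ) ∣ i - 1
      · have hq2 : ¬ (q : ℤ) ∣ i + 1 := by
          intro hq2
          have := dvd_sub hq2 hq1
          rw [show (i + 1) - (i - 1) = 2 by ring] at this
          have h4 := Int.le_of_dvd (by norm_num) this
          omega
        have hc : IsCoprime ((q : ℤ) ^ 2) (i + 1) :=
          ((Prime.coprime_iff_not_dvd hp).2 hq2).pow_left
        left
        have := key _ (hc.dvd_of_dvd_mul_right hd)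
        push_cast at this
        linear_combination this
      · have hc : IsCoprime ((q : ℤ) ^ 2) (i - 1) :=
          ((Prime.coprime_iff_not_dvd hp).2 hq1).pow_left
        right
        have := key _ (hc.dvd_of_dvd_mul_left hd)
        push_cast at this
        linear_combination this
    · rintro (rfl | rfl) <;> simp
  rw [this, Set.ncard_pair]
  have : Fact (2 < q ^ 2) := ⟨by nlinarith⟩
  exact ZMod.neg_one_ne_one.symm

theorem ncard_sq_eq_one_mul {m n : ℕ} (h : m.Coprime n) :
    {k : ZMod (m * n) | k ^ 2 = 1}.ncard =
      {k : ZMod m | k ^ 2 = 1}.ncard * {k : ZMod n | k ^ 2 = 1}.ncard := by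
  rw [← Set.ncard_prod]
  let e := ZMod.chineseRemainder h
  have : {k : ZMod m | k ^ 2 = 1} ×ˢ {k : ZMod n | k ^ 2 = 1} =
      e '' {k : ZMod (m * n) | k ^ 2 = 1} := by
    ext x
    simp only [Set.mem_prod, Set.mem_ofPred_eq, Set.mem_image]
    constructor
    · rintro ⟨h1, h2⟩
      refine ⟨e.symm x, ?_, by simp⟩
      rw [← map_pow]
      have : x ^ 2 = 1 := Prod.ext h1 h2
      rw [this, map_one]
    · rintro ⟨k, hk, rfl⟩
      have : e k ^ 2 = 1 := by rw [← map_pow, hk, map_one]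
      exact ⟨congrArg Prod.fst this, congrArg Prod.snd this⟩
  rw [this, Set.ncard_image_of_injective _ e.injective]

/-! ### Subgroup counts for orders q, qr and q² -/

theorem isCyclic_of_squarefree_card {A : Type*} [CommGroup A] (h : Squarefree (Nat.card A)) :
    IsCyclic A := by
  have : Finite A := Nat.finite_of_card_ne_zero h.ne_zero
  have := IsZGroup.of_squarefree h
  infer_instance

section CyclicSquare

variable {C : Type*} [CommGroup C]

theorem setOf_card_eq_of_squarefree {m : ℕ} (hm : Squarefree m) :
    {B : Subgroup (C × C) | Nat.card B = m} =
      {B : Subgroup (C × C) | Nat.card B = m ∧ IsCyclic B} := by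
  ext B
  simp only [Set.mem_ofPred_eq, iff_self_and]
  rintro rfl
  exact isCyclic_of_squarefree_card hm

theorem setOf_card_eq_of_not_dvd {m q : ℕ} (hq : q.Prime) (hqm : q ∣ m) (h : ¬ q ∣ Nat.card C) :
    {B : Subgroup (C × C) | Nat.card B = m} = ∅ := by
  ext B
  simp only [Set.mem_ofPred_eq, Set.mem_empty_iff_false, iff_false]
  rintro rfl
  have := Fact.mk hq
  have h1 : q ∣ Nat.card (C × C) := hqm.trans B.card_subgroup_dvd_card
  rw [Nat.card_prod, hq.dvd_mul] at h1
  tauto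

/-- The subgroup of elements of `C × C` killed by `q`. -/
def torsionProd (C : Type*) [CommGroup C] (q : ℕ) : Subgroup (C × C) :=
  (powMonoidHom q : C × C →* C × C).ker

theorem swapProd_torsionProd (q : ℕ) : (torsionProd C q).swapProd = torsionProd C q := by
  ext ⟨a, b⟩
  rw [Subgroup.mem_swapProd]
  simp [torsionProd, MonoidHom.mem_ker, and_comm]

variable [Finite C] [IsCyclic C]

theorem ncard_card_eq_prime {q : ℕ} (hq : q.Prime) (h : q ∣ Nat.card C) :
    {B : Subgroup (C × C) | Nat.card B = q}.ncard = q + 1 := by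
  rw [setOf_card_eq_of_squarefree hq.squarefree]
  have h1 := card_orderOf_eq_totient_mul_card_cyclic (C × C) q
  rw [ncard_prod_orderOf_prime hq h, Nat.totient_prime hq] at h1
  have h2 : q ^ 2 - 1 = (q - 1) * (q + 1) := by
    rw [mul_comm, ← Nat.sq_sub_sq, one_pow]
  rw [h2] at h1
  exact (Nat.eq_of_mul_eq_mul_left (Nat.sub_pos_of_lt hq.one_lt) h1).symm

theorem ncard_card_eq_prime_mul {q r : ℕ} (hq : q.Prime) (hr : r.Prime) (hqr : q ≠ r)
    (h : q * r ∣ Nat.card C) :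
    {B : Subgroup (C × C) | Nat.card B = q * r}.ncard = (q + 1) * (r + 1) := by
  have hcop : q.Coprime r := (Nat.coprime_primes hq hr).2 hqr
  rw [setOf_card_eq_of_squarefree ((Nat.squarefree_mul hcop).2 ⟨hq.squarefree, hr.squarefree⟩)]
  have h1 := card_orderOf_eq_totient_mul_card_cyclic (C × C) (q * r)
  rw [ncard_prod_orderOf_prime_mul hq hr hqr h, Nat.totient_mul hcop, Nat.totient_prime hq,
    Nat.totient_prime hr] at h1
  have h2 : ∀ s, s ^ 2 - 1 = (s - 1) * (s + 1) := by
    intro s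
    rw [mul_comm, ← Nat.sq_sub_sq, one_pow]
  rw [h2, h2, mul_mul_mul_comm] at h1
  exact (Nat.eq_of_mul_eq_mul_left (mul_pos (Nat.sub_pos_of_lt hq.one_lt)
    (Nat.sub_pos_of_lt hr.one_lt)) h1).symm

theorem ncard_card_eq_swap_fixed_of_squarefree {m : ℕ} (hm : Squarefree m)
    (h : m ∣ Nat.card C) :
    {B : Subgroup (C × C) | Nat.card B = m ∧ B.swapProd = B}.ncard =
      {k : ZMod m | k ^ 2 = 1}.ncard := by
  have : NeZero m := ⟨hm.ne_zero⟩
  rw [← ncard_cyclic_swap_fixed h]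
  congr 1
  ext B
  have := Set.ext_iff.1 (setOf_card_eq_of_squarefree (C := C) hm) B
  exact and_congr_left' this

theorem card_torsionProd {q : ℕ} (h : q ∣ Nat.card C) :
    Nat.card (torsionProd C q) = q ^ 2 := by
  conv_rhs => rw [← Nat.gcd_eq_right h, ← ncard_prod_pow_eq_one]
  rw [← Nat.card_coe_set_eq]
  rfl

/-- Without an element of order q², every element of B is killed by q. Thus B sits inside the
q-torsion, which already has only q² elements. -/
theorem eq_torsionProd {q : ℕ} (hq : q.Prime) (h : q ∣ Nat.card C) {B : Subgroup (C × C)}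
    (hB : Nat.card B = q ^ 2) (hx : ∀ x ∈ B, orderOf x ≠ q ^ 2) : B = torsionProd C q := by
  apply Subgroup.eq_of_le_of_card_ge
  · intro x hxB
    have h1 : orderOf x ∣ q ^ 2 := hB ▸ Subgroup.orderOf_dvd_natCard _ hxB
    obtain ⟨k, hk, hk'⟩ := (Nat.dvd_prime_pow hq).1 h1
    have h2 : k ≠ 2 := by
      rintro rfl
      exact hx x hxB hk'
    have h3 : orderOf x ∣ q := by
      rw [hk']
      conv_rhs => rw [← pow_one q]
      exact pow_dvd_pow _ (by omega)
    exact orderOf_dvd_iff_pow_eq_one.1 h3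
  · rw [card_torsionProd h, hB]

theorem not_isCyclic_torsionProd {q : ℕ} (hq : q.Prime) (h : q ∣ Nat.card C) :
    ¬ IsCyclic (torsionProd C q) := by
  intro hc
  obtain ⟨x, hx⟩ := (Subgroup.isCyclic_iff_exists_zpowers_eq_top _).1 hc
  have h1 : x ∈ torsionProd C q := hx ▸ Subgroup.mem_zpowers x
  have h2 : orderOf x ∣ q := orderOf_dvd_iff_pow_eq_one.2 h1
  rw [← Nat.card_zpowers, hx, card_torsionProd h] at h2
  have := Nat.le_of_dvd hq.pos h2
  have := hq.one_lt
  nlinarith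

theorem setOf_card_eq_prime_sq {q : ℕ} (hq : q.Prime) (h : q ∣ Nat.card C) :
    {B : Subgroup (C × C) | Nat.card B = q ^ 2} =
      insert (torsionProd C q) {B : Subgroup (C × C) | Nat.card B = q ^ 2 ∧ IsCyclic B} := by
  ext B
  simp only [Set.mem_ofPred_eq, Set.mem_insert_iff]
  constructor
  · intro hB
    by_cases hx : ∀ x ∈ B, orderOf x ≠ q ^ 2
    · exact Or.inl (eq_torsionProd hq h hB hx)
    · push Not at hx
      obtain ⟨x, hx, hx'⟩ := hx
      refine Or.inr ⟨hB, isCyclic_of_orderOf_eq_card (⟨x, hx⟩ : B) ?_⟩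
      rw [Subgroup.orderOf_mk, hx', hB]
  · rintro (rfl | hB)
    · exact card_torsionProd h
    · exact hB.1

theorem ncard_card_eq_prime_sq {q : ℕ} (hq : q.Prime) (h : q ^ 2 ∣ Nat.card C) :
    {B : Subgroup (C × C) | Nat.card B = q ^ 2}.ncard = q ^ 2 + q + 1 := by
  have hq1 : q ∣ Nat.card C := (dvd_pow_self q two_ne_zero).trans h
  rw [setOf_card_eq_prime_sq hq hq1, Set.ncard_insert_of_notMem]
  · have h1 := card_orderOf_eq_totient_mul_card_cyclic (C × C) (q ^ 2)
    rw [ncard_prod_orderOf_prime_sq hq h, Nat.totient_prime_pow hq two_pos] at h1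
    -- Elements of order q² divided by φ(q²) = q(q - 1); the remaining 1 in the total is the
    -- q-torsion subgroup.
    have h2 : q ^ 4 - q ^ 2 = q ^ (2 - 1) * (q - 1) * (q ^ 2 + q) := by
      obtain ⟨s, rfl⟩ := Nat.exists_eq_add_of_le hq.one_le
      simp only [add_tsub_cancel_left]
      rw [Nat.sub_eq_iff_eq_add (Nat.pow_le_pow_right (by omega) (by norm_num))]
      norm_num
      ring
    rw [h2] at h1
    rw [Nat.eq_of_mul_eq_mul_left (mul_pos (pow_pos hq.pos _) (Nat.sub_pos_of_lt hq.one_lt)) h1]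
  · exact fun hc => not_isCyclic_torsionProd hq hq1 hc.2

theorem ncard_card_eq_prime_sq_swap_fixed {q : ℕ} (hq : q.Prime) (h : q ^ 2 ∣ Nat.card C) :
    {B : Subgroup (C × C) | Nat.card B = q ^ 2 ∧ B.swapProd = B}.ncard =
      {k : ZMod (q ^ 2) | k ^ 2 = 1}.ncard + 1 := by
  have : NeZero (q ^ 2) := ⟨pow_ne_zero _ hq.ne_zero⟩
  have hq1 : q ∣ Nat.card C := (dvd_pow_self q two_ne_zero).trans h
  rw [← ncard_cyclic_swap_fixed h, ← Set.ncard_insert_of_notMem (a := torsionProd C q)]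
  · congr 1
    ext B
    have := Set.ext_iff.1 (setOf_card_eq_prime_sq hq hq1) B
    simp only [Set.mem_ofPred_eq, Set.mem_insert_iff] at this ⊢
    refine (and_congr_left' this).trans ?_
    rw [or_and_right]
    constructor
    · rintro (h | h)
      · exact Or.inl h.1
      · exact Or.inr h
    · rintro (h | h)
      · exact Or.inl ⟨h, h ▸ swapProd_torsionProd q⟩
      · exact Or.inr h
  · exact fun hc => not_isCyclic_torsionProd hq hq1 hc.1.2

/-- The exponent of C × C divides |C|, so there is no element of order q² and only the noncyclic
subgroup survives. -/
theorem setOf_card_eq_prime_sq_of_not_dvd {q : ℕ} (hq : q.Prime) (h : q ∣ Nat.card C)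
    (h' : ¬ q ^ 2 ∣ Nat.card C) :
    {B : Subgroup (C × C) | Nat.card B = q ^ 2} = {torsionProd C q} := by
  rw [setOf_card_eq_prime_sq hq h]
  suffices hs : {B : Subgroup (C × C) | Nat.card B = q ^ 2 ∧ IsCyclic B} = ∅ by
    rw [hs, insert_empty_eq]
  refine Set.eq_empty_iff_forall_notMem.2 fun B => ?_
  rintro ⟨hB, hc⟩
  obtain ⟨x, hx⟩ := (Subgroup.isCyclic_iff_exists_zpowers_eq_top _).1 hc
  apply h'
  rw [← hB, ← hx, Nat.card_zpowers, orderOf_dvd_iff_pow_eq_one]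
  ext
  · exact pow_card_eq_one'
  · exact pow_card_eq_one'

end CyclicSquare

/-! ### Conjugacy, centralizers and semisimplicity of 2 × 2 matrices -/

namespace Matrix

variable {k : Type*} [Field k]

/-- A `2 × 2` matrix that is not a multiple of the identity. -/
def NonScalar (A : Matrix (Fin 2) (Fin 2) k) : Prop :=
  A 0 1 ≠ 0 ∨ A 1 0 ≠ 0 ∨ A 0 0 ≠ A 1 1

theorem not_nonScalar_iff {A : Matrix (Fin 2) (Fin 2) k} :
    ¬ A.NonScalar ↔ A = A 0 0 • (1 : Matrix (Fin 2) (Fin 2) k) := by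
  rw [NonScalar]
  push Not
  constructor
  · rintro ⟨h1, h2, h3⟩
    ext i j
    fin_cases i <;> fin_cases j <;> simp [h1, h2, h3]
  · intro h
    rw [h]
    simp

theorem not_nonScalar_smul_one (c : k) : ¬ (c • (1 : Matrix (Fin 2) (Fin 2) k)).NonScalar := by
  simp [NonScalar]

theorem mul_self_fin_two (A : Matrix (Fin 2) (Fin 2) k) :
    A * A = A.trace • A - A.det • (1 : Matrix (Fin 2) (Fin 2) k) := by
  ext i j
  fin_cases i <;> fin_cases j <;>
    simp [Matrix.mul_apply, Fin.sum_univ_two, det_fin_two, trace_fin_two] <;> ring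

/-- A nonscalar 2 × 2 matrix has a cyclic vector v, and in the basis v, Av it becomes its companion
matrix by Cayley–Hamilton. One of e₁, e₂, e₁ + e₂ is always cyclic; in `key`, v = (x, y). -/
theorem NonScalar.exists_mul_eq_mul_companion {A : Matrix (Fin 2) (Fin 2) k} (hA : A.NonScalar) :
    ∃ P : GL (Fin 2) k, A * (P : Matrix (Fin 2) (Fin 2) k) =
      (P : Matrix (Fin 2) (Fin 2) k) * !![0, -A.det; 1, A.trace] := by
  suffices h : ∃ P : Matrix (Fin 2) (Fin 2) k, P.det ≠ 0 ∧
      A * P = P * !![0, -A.det; 1, A.trace] by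
    obtain ⟨P, hP, h⟩ := h
    exact ⟨GeneralLinearGroup.mkOfDetNeZero P hP, h⟩
  have key : ∀ x y : k, A * !![x, A 0 0 * x + A 0 1 * y; y, A 1 0 * x + A 1 1 * y] =
      !![x, A 0 0 * x + A 0 1 * y; y, A 1 0 * x + A 1 1 * y] * !![0, -A.det; 1, A.trace] := by
    intro x y
    ext i j
    fin_cases i <;> fin_cases j <;>
      simp [Matrix.mul_apply, Fin.sum_univ_two, det_fin_two, trace_fin_two] <;> ring
  by_cases h1 : A 1 0 = 0
  · by_cases h2 : A 0 1 = 0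
    · refine ⟨_, ?_, key 1 1⟩
      rcases hA with h | h | h
      · exact absurd h2 h
      · exact absurd h1 h
      · simp only [det_fin_two_of, h1, h2]
        intro h'
        apply h
        linear_combination -h'
    · refine ⟨_, ?_, key 0 1⟩
      simpa [det_fin_two_of] using h2
  · refine ⟨_, ?_, key 1 0⟩
    simpa [det_fin_two_of] using h1

theorem NonScalar.exists_conj {A B : Matrix (Fin 2) (Fin 2) k} (hA : A.NonScalar)
    (hB : B.NonScalar) (ht : A.trace = B.trace) (hd : A.det = B.det) :
    ∃ g : GL (Fin 2) k, (g : Matrix (Fin 2) (Fin 2) k) * A = B * g := by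
  obtain ⟨P, hP⟩ := hA.exists_mul_eq_mul_companion
  obtain ⟨Q, hQ⟩ := hB.exists_mul_eq_mul_companion
  rw [ht, hd] at hP
  refine ⟨Q * P⁻¹, ?_⟩
  have h1 : ((P⁻¹ : GL (Fin 2) k) : Matrix (Fin 2) (Fin 2) k) * A =
      !![0, -B.det; 1, B.trace] * ((P⁻¹ : GL (Fin 2) k) : Matrix (Fin 2) (Fin 2) k) := by
    calc _ = ((P⁻¹ : GL (Fin 2) k) : Matrix (Fin 2) (Fin 2) k) * (A * P) *
          ((P⁻¹ : GL (Fin 2) k) : Matrix (Fin 2) (Fin 2) k) := by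
            rw [mul_assoc, mul_assoc, Units.mul_inv, mul_one]
      _ = _ := by rw [hP, ← mul_assoc, Units.inv_mul, one_mul]
  rw [Units.val_mul, mul_assoc, h1, ← mul_assoc, ← hQ, mul_assoc]

/-- The centralizer of A is k[A]. The coefficient y is read off as a quotient at whichever of the
two off-diagonal entries or the diagonal difference of A is nonzero. -/
theorem NonScalar.exists_of_commute {A M : Matrix (Fin 2) (Fin 2) k} (hA : A.NonScalar)
    (h : A * M = M * A) : ∃ x y : k, M = x • (1 : Matrix (Fin 2) (Fin 2) k) + y • A := by
  have e := fun i j => congrFun (congrFun h i) j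
  have e00 := e 0 0
  have e01 := e 0 1
  have e10 := e 1 0
  simp only [Matrix.mul_apply, Fin.sum_univ_two] at e00 e01 e10
  have key : ∀ x y : k, M 0 0 = x + y * A 0 0 → M 0 1 = y * A 0 1 → M 1 0 = y * A 1 0 →
      M 1 1 = x + y * A 1 1 → M = x • (1 : Matrix (Fin 2) (Fin 2) k) + y • A := by
    intro x y h1 h2 h3 h4
    ext i j
    fin_cases i <;> fin_cases j <;> simp [h1, h2, h3, h4]
  rcases hA with h1 | h1 | h1
  · refine ⟨M 0 0 - M 0 1 / A 0 1 * A 0 0, M 0 1 / A 0 1, key _ _ ?_ ?_ ?_ ?_⟩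
    · ring
    · field_simp
    · field_simp
      linear_combination e00
    · field_simp
      linear_combination e01
  · refine ⟨M 0 0 - M 1 0 / A 1 0 * A 0 0, M 1 0 / A 1 0, key _ _ ?_ ?_ ?_ ?_⟩
    · ring
    · field_simp
      linear_combination -e00
    · field_simp
    · field_simp
      linear_combination -e10
  · have h1' : A 0 0 - A 1 1 ≠ 0 := sub_ne_zero.2 h1
    refine ⟨M 0 0 - (M 0 0 - M 1 1) / (A 0 0 - A 1 1) * A 0 0,
      (M 0 0 - M 1 1) / (A 0 0 - A 1 1), key _ _ ?_ ?_ ?_ ?_⟩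
    · ring
    · field_simp
      linear_combination e01
    · field_simp
      linear_combination -e10
    · field_simp
      ring

/-- Write h = e + N with N² = 0. Then 1 = h ^ n = e ^ n + n e ^ (n - 1) N. If N ≠ 0, multiplying by
N gives e ^ n = 1, and then n e ^ (n - 1) N = 0 is impossible since n is invertible. -/
theorem eq_smul_one_of_pow_eq_one {h : Matrix (Fin 2) (Fin 2) k} {e : k} {n : ℕ}
    (hn : (n : k) ≠ 0) (hpow : h ^ n = 1)
    (hsq : (h - e • (1 : Matrix (Fin 2) (Fin 2) k)) * (h - e • (1 : Matrix (Fin 2) (Fin 2) k)) = 0) :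
    h = e • (1 : Matrix (Fin 2) (Fin 2) k) := by
  set N := h - e • (1 : Matrix (Fin 2) (Fin 2) k) with hN
  obtain ⟨s, hs⟩ := Polynomial.powAddExpansion (Polynomial.C e) (Polynomial.X - Polynomial.C e) n
  have haN : Polynomial.aeval h (Polynomial.X - Polynomial.C e) = N := by
    simp [hN, Algebra.algebraMap_eq_smul_one]
  have h1 := congrArg (Polynomial.aeval h) hs
  simp only [add_sub_cancel, map_add, map_mul, map_pow, haN, Polynomial.aeval_X, hpow, sq N, hsq,
    mul_zero, add_zero, Polynomial.aeval_C, map_natCast] at h1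
  have h2 : (1 : Matrix (Fin 2) (Fin 2) k) = e ^ n • 1 + ((n : k) * e ^ (n - 1)) • N := by
    refine h1.trans ?_
    rw [← map_natCast (algebraMap k (Matrix (Fin 2) (Fin 2) k)) n, ← map_pow, ← map_pow,
      ← map_mul, Algebra.algebraMap_eq_smul_one, Algebra.algebraMap_eq_smul_one, smul_mul_assoc,
      one_mul]
  by_contra hne
  have hN0 : N ≠ 0 := sub_ne_zero.2 hne
  have h3 : N = e ^ n • N := by
    have := congrArg (· * N) h2
    simpa only [one_mul, add_mul, smul_mul_assoc, hsq, smul_zero, add_zero] using this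
  have h4 : e ^ n = 1 := by
    have : (1 - e ^ n) • N = 0 := by rw [sub_smul, one_smul, ← h3, sub_self]
    rcases smul_eq_zero.1 this with h | h
    · exact (sub_eq_zero.1 h).symm
    · exact absurd h hN0
  rw [h4, one_smul, left_eq_add, smul_eq_zero] at h2
  rcases h2 with h2 | h2
  · rcases mul_eq_zero.1 h2 with h | h
    · exact hn h
    · have he : e = 0 := eq_zero_of_pow_eq_zero h
      have hn0 : n ≠ 0 := by rintro rfl; exact hn (by simp)
      rw [he, zero_pow hn0] at h4
      exact zero_ne_one h4
  · exact hN0 h2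

/-- A double root l of the characteristic polynomial would give (A - l)² = 0, and order prime to the
characteristic would then make A scalar. -/
theorem NonScalar.root_ne {A : Matrix (Fin 2) (Fin 2) k} (hA : A.NonScalar) {n : ℕ}
    (hn : (n : k) ≠ 0) (hpow : A ^ n = 1) {l : k} (hl : l * l = A.trace * l - A.det) :
    l ≠ A.trace - l := by
  intro h
  have hA' : A = l • (1 : Matrix (Fin 2) (Fin 2) k) := by
    apply eq_smul_one_of_pow_eq_one hn hpow
    have h2 : A.trace = l + l := by linear_combination -h
    have h3 : A.det = l * l := by rw [h2] at hl; linear_combination hl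
    have := mul_self_fin_two A
    rw [h2, h3] at this
    rw [sub_mul, mul_sub, mul_sub, this]
    simp only [smul_mul_assoc, mul_smul_comm, one_mul, mul_one, smul_smul, add_smul]
    abel
  exact not_nonScalar_smul_one l (hA' ▸ hA)

theorem NonScalar.exists_conj_diagonal {A : Matrix (Fin 2) (Fin 2) k} (hA : A.NonScalar) {l : k}
    (hl : l * l = A.trace * l - A.det) (hne : l ≠ A.trace - l) :
    ∃ g : GL (Fin 2) k, (g : Matrix (Fin 2) (Fin 2) k) * A = !![l, 0; 0, A.trace - l] * g := by
  apply hA.exists_conj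
  · exact Or.inr (Or.inr hne)
  · simp [trace_fin_two]
  · rw [det_fin_two_of]
    linear_combination hl

theorem NonScalar.of_mul_eq {A B : Matrix (Fin 2) (Fin 2) k} (hA : A.NonScalar) (g : GL (Fin 2) k)
    (h : (g : Matrix (Fin 2) (Fin 2) k) * A = B * g) : B.NonScalar := by
  by_contra hB
  rw [not_nonScalar_iff] at hB
  have : A = B 0 0 • (1 : Matrix (Fin 2) (Fin 2) k) := by
    calc A = ((g⁻¹ : GL (Fin 2) k) : Matrix (Fin 2) (Fin 2) k) * (g * A) := by
          rw [← mul_assoc, Units.inv_mul, one_mul]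
      _ = _ := by rw [h, hB]; simp
  exact not_nonScalar_smul_one _ (this ▸ hA)

end Matrix

/-! ### The field with p² elements and the nonsplit torus -/

section QuadraticExtension

variable (p : ℕ) [Fact p.Prime]

/-- Either the quadratic has a root in the prime field, or it is irreducible and the degree-two
field it defines embeds in the field with p² elements. -/
theorem GaloisField.exists_quadratic_root (t d : ZMod p) :
    ∃ a : GaloisField p 2, a * a =
      algebraMap (ZMod p) (GaloisField p 2) t * a - algebraMap (ZMod p) (GaloisField p 2) d := by
  by_cases h : ∃ x : ZMod p, x * x = t * x - d
  · obtain ⟨x, hx⟩ := h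
    refine ⟨algebraMap _ _ x, ?_⟩
    rw [← map_mul, ← map_mul, ← map_sub, hx]
  · push Not at h
    let f : Polynomial (ZMod p) :=
      Polynomial.X ^ 2 - Polynomial.C t * Polynomial.X + Polynomial.C d
    have hdeg : f.natDegree = 2 := by
      simp only [f]
      compute_degree!
    have hirr : Irreducible f := by
      apply Polynomial.irreducible_of_degree_le_three_of_not_isRoot
      · simp [hdeg]
      · intro x hx
        apply h x
        have : x ^ 2 - t * x + d = 0 := by simpa [f, Polynomial.IsRoot] using hx
        linear_combination this
    have := Fact.mk hirr
    have hfin : Module.finrank (ZMod p) (AdjoinRoot f) = 2 := by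
      rw [(AdjoinRoot.powerBasis hirr.ne_zero).finrank, AdjoinRoot.powerBasis_dim, hdeg]
    obtain ⟨φ⟩ := FiniteField.nonempty_algHom_of_finrank_dvd (F := ZMod p) (K := AdjoinRoot f)
      (L := GaloisField p 2) (by rw [hfin, GaloisField.finrank p two_ne_zero])
    refine ⟨φ (AdjoinRoot.root f), ?_⟩
    have h1 : Polynomial.aeval (φ (AdjoinRoot.root f)) f = 0 := by
      rw [Polynomial.aeval_algHom_apply, AdjoinRoot.aeval_eq, AdjoinRoot.mk_self, map_zero]
    simp only [f, map_add, map_sub, map_mul, map_pow, Polynomial.aeval_X,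
      Polynomial.aeval_C] at h1
    linear_combination h1

variable {p} in
theorem GaloisField.exists_algebraMap_eq {n : ℕ} {x : GaloisField p n} (h : x ^ p = x) :
    ∃ y : ZMod p, algebraMap (ZMod p) (GaloisField p n) y = x := by
  rw [← Subfield.mem_bot_iff_pow_eq_self, mem_bot_iff_intCast p] at h
  obtain ⟨i, rfl⟩ := h
  exact ⟨i, by simp⟩

theorem GaloisField.card_units_two : Nat.card (GaloisField p 2)ˣ = p ^ 2 - 1 := by
  rw [Nat.card_units, GaloisField.card p 2 two_ne_zero]

/-- The regular representation of the quadratic extension of `ZMod p`. -/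
noncomputable def quadMul :
    GaloisField p 2 →ₐ[ZMod p] Matrix (Fin 2) (Fin 2) (ZMod p) :=
  Algebra.leftMulMatrix
    (Module.finBasisOfFinrankEq (ZMod p) (GaloisField p 2) (GaloisField.finrank p two_ne_zero))

theorem quadMul_injective : Function.Injective (quadMul p) :=
  Algebra.leftMulMatrix_injective _

variable {p}

theorem nonScalar_quadMul_iff {x : GaloisField p 2} :
    (quadMul p x).NonScalar ↔ ∀ c : ZMod p, algebraMap _ _ c ≠ x := by
  constructor
  · rintro h c rfl
    rw [AlgHom.commutes, Algebra.algebraMap_eq_smul_one] at h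
    exact Matrix.not_nonScalar_smul_one c h
  · intro h
    by_contra hn
    rw [Matrix.not_nonScalar_iff, ← Algebra.algebraMap_eq_smul_one,
      ← AlgHom.commutes (quadMul p)] at hn
    exact h _ (quadMul_injective p hn).symm

/-- Subtracting the given quadratic relation from Cayley–Hamilton leaves a linear relation between
the nonscalar matrix of x and the identity, so both its coefficients vanish. -/
theorem trace_det_quadMul {x : GaloisField p 2} (hx : ∀ c : ZMod p, algebraMap _ _ c ≠ x)
    {t d : ZMod p} (h : x * x = algebraMap _ _ t * x - algebraMap _ _ d) :
    (quadMul p x).trace = t ∧ (quadMul p x).det = d := by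
  have hn := nonScalar_quadMul_iff.2 hx
  have h1 := congrArg (quadMul p) h
  rw [map_mul, map_sub, map_mul, AlgHom.commutes, AlgHom.commutes, Matrix.mul_self_fin_two,
    Algebra.algebraMap_eq_smul_one, Algebra.algebraMap_eq_smul_one, smul_mul_assoc, one_mul] at h1
  have h2 : ((quadMul p x).trace - t) • quadMul p x =
      ((quadMul p x).det - d) • (1 : Matrix (Fin 2) (Fin 2) (ZMod p)) := by
    rw [sub_smul, sub_smul, sub_eq_sub_iff_sub_eq_sub]
    rw [sub_eq_sub_iff_add_eq_add] at h1 ⊢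
    rw [h1, add_comm]
  have h3 : (quadMul p x).trace - t = 0 := by
    by_contra h3
    apply Matrix.not_nonScalar_smul_one (((quadMul p x).trace - t)⁻¹ * ((quadMul p x).det - d))
    rw [mul_smul, ← h2, smul_smul, inv_mul_cancel₀ h3, one_smul]
    exact hn
  refine ⟨sub_eq_zero.1 h3, ?_⟩
  rw [h3, zero_smul, eq_comm, smul_eq_zero] at h2
  exact sub_eq_zero.1 (h2.resolve_right one_ne_zero)

theorem Matrix.NonScalar.exists_conj_quadMul {A : Matrix (Fin 2) (Fin 2) (ZMod p)}
    (hA : A.NonScalar) (h : ∀ l : ZMod p, l * l ≠ A.trace * l - A.det) :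
    ∃ (g : GL (Fin 2) (ZMod p)) (x : GaloisField p 2), (∀ c : ZMod p, algebraMap _ _ c ≠ x) ∧
      (g : Matrix (Fin 2) (Fin 2) (ZMod p)) * A = quadMul p x * g := by
  obtain ⟨x, hx⟩ := GaloisField.exists_quadratic_root p A.trace A.det
  have hx' : ∀ c : ZMod p, algebraMap _ _ c ≠ x := by
    rintro c rfl
    rw [← map_mul, ← map_mul, ← map_sub] at hx
    exact h c ((algebraMap (ZMod p) (GaloisField p 2)).injective hx)
  obtain ⟨h1, h2⟩ := trace_det_quadMul hx' hx
  obtain ⟨g, hg⟩ := hA.exists_conj (nonScalar_quadMul_iff.2 hx') h1.symm h2.symm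
  exact ⟨g, x, hx', hg⟩

variable (p) in
/-- The nonsplit torus: the action of the units of the quadratic extension. -/
noncomputable def quadHom : (GaloisField p 2)ˣ →* GL (Fin 2) (ZMod p) :=
  Units.map (quadMul p : GaloisField p 2 →* Matrix (Fin 2) (Fin 2) (ZMod p))

theorem quadHom_injective : Function.Injective (quadHom p) :=
  Units.map_injective (quadMul_injective p)

theorem coe_quadHom (x : (GaloisField p 2)ˣ) :
    (quadHom p x : Matrix (Fin 2) (Fin 2) (ZMod p)) = quadMul p x := rfl

theorem mem_range_quadHom_of_commute {x : GaloisField p 2}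
    (hx : ∀ c : ZMod p, algebraMap _ _ c ≠ x) {M : GL (Fin 2) (ZMod p)}
    (h : quadMul p x * (M : Matrix (Fin 2) (Fin 2) (ZMod p)) = M * quadMul p x) :
    M ∈ (quadHom p).range := by
  obtain ⟨a, b, hab⟩ := (nonScalar_quadMul_iff.2 hx).exists_of_commute h
  have h1 : quadMul p (algebraMap _ _ a + algebraMap _ _ b * x) = M := by
    rw [map_add, map_mul, AlgHom.commutes, AlgHom.commutes, hab, Algebra.algebraMap_eq_smul_one,
      Algebra.algebraMap_eq_smul_one, smul_mul_assoc, one_mul]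
  have h2 : algebraMap _ _ a + algebraMap _ _ b * x ≠ 0 := by
    intro h0
    rw [h0, map_zero] at h1
    exact M.ne_zero h1.symm
  exact ⟨Units.mk0 _ h2, Units.ext h1⟩

end QuadraticExtension

/-! ### The split torus and fusion of its subgroups -/

section DiagonalTorus

variable {k : Type*} [Field k]

/-- The split torus of diagonal matrices in `GL₂`. -/
def diagHom (k : Type*) [Field k] : kˣ × kˣ →* GL (Fin 2) k where
  toFun x :=
    { val := !![(x.1 : k), 0; 0, (x.2 : k)]
      inv := !![((x.1⁻¹ : kˣ) : k), 0; 0, ((x.2⁻¹ : kˣ) : k)]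
      val_inv := by simp [Matrix.one_fin_two]
      inv_val := by simp [Matrix.one_fin_two] }
  map_one' := by
    ext i j
    fin_cases i <;> fin_cases j <;> simp
  map_mul' x y := by
    ext i j
    fin_cases i <;> fin_cases j <;> simp

theorem coe_diagHom (x : kˣ × kˣ) :
    (diagHom k x : Matrix (Fin 2) (Fin 2) k) = !![(x.1 : k), 0; 0, (x.2 : k)] := rfl

theorem diagHom_injective : Function.Injective (diagHom k) := by
  intro x y h
  have h' := congrArg Units.val h
  rw [coe_diagHom, coe_diagHom] at h'
  ext
  · simpa using congrFun (congrFun h' 0) 0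
  · simpa using congrFun (congrFun h' 1) 1

theorem mem_range_diagHom {M : GL (Fin 2) k} (h1 : M.1 0 1 = 0) (h2 : M.1 1 0 = 0) :
    M ∈ (diagHom k).range := by
  have hd : M.1.det ≠ 0 := M.isUnit.map Matrix.detMonoidHom |>.ne_zero
  rw [Matrix.det_fin_two, h1, h2, mul_zero, sub_zero] at hd
  refine ⟨(Units.mk0 _ (left_ne_zero_of_mul hd), Units.mk0 _ (right_ne_zero_of_mul hd)), ?_⟩
  apply Units.ext
  rw [coe_diagHom]
  ext i j
  fin_cases i <;> fin_cases j <;> simp [h1, h2]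

theorem mem_range_diagHom_of_not_nonScalar {M : GL (Fin 2) k} (h : ¬ M.1.NonScalar) :
    M ∈ (diagHom k).range := by
  rw [Matrix.NonScalar] at h
  push Not at h
  exact mem_range_diagHom h.1 h.2.1

theorem mem_range_diagHom_of_commute {a b : k} (hab : a ≠ b) {M : GL (Fin 2) k}
    (h : !![a, 0; 0, b] * M.1 = M.1 * !![a, 0; 0, b]) : M ∈ (diagHom k).range := by
  obtain ⟨x, y, hxy⟩ := Matrix.NonScalar.exists_of_commute
    (show (!![a, 0; 0, b] : Matrix (Fin 2) (Fin 2) k).NonScalar from Or.inr (Or.inr hab)) h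
  apply mem_range_diagHom <;> simp [hxy]

theorem exists_conj_diagHom_swap :
    ∃ w : GL (Fin 2) k, ∀ x, w * diagHom k x * w⁻¹ = diagHom k x.swap := by
  refine ⟨Matrix.GeneralLinearGroup.mkOfDetNeZero !![0, 1; 1, 0] (by simp [Matrix.det_fin_two_of]),
    fun x => ?_⟩
  rw [mul_inv_eq_iff_eq_mul]
  apply Units.ext
  rw [Units.val_mul, Units.val_mul, coe_diagHom, coe_diagHom]
  change !![0, 1; 1, 0] * _ = _ * !![0, 1; 1, 0]
  simp

/-- Since x has distinct entries, g carries its eigenlines, the coordinate axes, to the eigenlines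
of another diagonal matrix, so g is monomial. Whether `g 0 0` vanishes separates the antidiagonal
case from the diagonal one. -/
theorem conj_diagHom_eq_or_swap {g : GL (Fin 2) k} {x y : kˣ × kˣ} (hx : x.1 ≠ x.2)
    (h : g * diagHom k x * g⁻¹ = diagHom k y) :
    (∀ z, g * diagHom k z * g⁻¹ = diagHom k z) ∨
      (∀ z, g * diagHom k z * g⁻¹ = diagHom k z.swap) := by
  rw [mul_inv_eq_iff_eq_mul] at h
  have h' := congrArg Units.val h
  rw [Units.val_mul, Units.val_mul, coe_diagHom, coe_diagHom] at h'
  have e := fun i j => congrFun (congrFun h' i) j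
  have e00 := e 0 0
  have e01 := e 0 1
  have e10 := e 1 0
  have e11 := e 1 1
  simp only [Matrix.mul_apply, Fin.sum_univ_two, Matrix.of_apply, Matrix.cons_val_zero,
    Matrix.cons_val_one, Matrix.cons_val', mul_zero, add_zero, zero_mul, zero_add,
    Matrix.cons_val_fin_one] at e00 e01 e10 e11
  have hd : g.1.det ≠ 0 := g.isUnit.map Matrix.detMonoidHom |>.ne_zero
  rw [Matrix.det_fin_two] at hd
  have hx' : (x.1 : k) - x.2 ≠ 0 := sub_ne_zero.2 fun h => hx (Units.ext h)
  by_cases h0 : g.1 0 0 = 0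
  · right
    intro z
    have h1 : g.1 0 1 ≠ 0 := fun h1 => hd (by rw [h0, h1]; ring)
    have h2 : g.1 1 0 ≠ 0 := fun h2 => hd (by rw [h0, h2]; ring)
    have h3 : g.1 1 1 = 0 := by
      have : (x.1 : k) = y.2 := mul_left_cancel₀ h2 (by rw [e10, mul_comm])
      have : ((x.1 : k) - x.2) * g.1 1 1 = 0 := by rw [this]; linear_combination -e11
      exact (mul_eq_zero.1 this).resolve_left hx'
    rw [mul_inv_eq_iff_eq_mul]
    apply Units.ext
    rw [Units.val_mul, Units.val_mul, coe_diagHom, coe_diagHom]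
    ext i j
    fin_cases i <;> fin_cases j <;> simp [Matrix.mul_apply, Fin.sum_univ_two, h0, h3, mul_comm]
  · left
    intro z
    have h4 : (x.1 : k) = y.1 := mul_left_cancel₀ h0 (by rw [e00, mul_comm])
    have h1 : g.1 0 1 = 0 := by
      have : ((x.1 : k) - x.2) * g.1 0 1 = 0 := by rw [h4]; linear_combination -e01
      exact (mul_eq_zero.1 this).resolve_left hx'
    have h3 : g.1 1 1 ≠ 0 := fun h3 => hd (by rw [h1, h3]; ring)
    have h5 : (x.2 : k) = y.2 := mul_left_cancel₀ h3 (by rw [e11, mul_comm])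
    have h2 : g.1 1 0 = 0 := by
      have : ((x.1 : k) - x.2) * g.1 1 0 = 0 := by rw [h5]; linear_combination e10
      exact (mul_eq_zero.1 this).resolve_left hx'
    rw [mul_inv_eq_iff_eq_mul]
    apply Units.ext
    rw [Units.val_mul, Units.val_mul, coe_diagHom]
    ext i j
    fin_cases i <;> fin_cases j <;> simp [Matrix.mul_apply, Fin.sum_univ_two, h1, h2, mul_comm]

theorem conj_diagHom_of_eq (g : GL (Fin 2) k) {x : kˣ × kˣ} (hx : x.1 = x.2) :
    g * diagHom k x * g⁻¹ = diagHom k x := by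
  rw [mul_inv_eq_iff_eq_mul]
  apply Units.ext
  rw [Units.val_mul, Units.val_mul, coe_diagHom, hx]
  have : (!![(x.2 : k), 0; 0, (x.2 : k)] : Matrix (Fin 2) (Fin 2) k) = (x.2 : k) • 1 := by
    simp [Matrix.one_fin_two]
  rw [this, mul_smul_comm, smul_mul_assoc, mul_one, one_mul]

/-- A nonscalar element of B forces g to act on the whole torus as the identity or as the swap; a
group of scalars is fixed by every g. -/
theorem exists_conj_map_diagHom_iff (B B' : Subgroup (kˣ × kˣ)) :
    (∃ g : GL (Fin 2) k, (B.map (diagHom k)).map (MulAut.conj g).toMonoidHom = B'.map (diagHom k)) ↔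
      B' = B ∨ B' = B.swapProd := by
  constructor
  · rintro ⟨g, hg⟩
    have hmap : ∀ σ : kˣ × kˣ ≃* kˣ × kˣ,
        (∀ z ∈ B, g * diagHom k z * g⁻¹ = diagHom k (σ z)) → B' = B.map σ.toMonoidHom := by
      intro σ hσ
      apply Subgroup.map_injective diagHom_injective
      rw [← hg]
      ext x
      simp only [Subgroup.mem_map]
      constructor
      · rintro ⟨_, ⟨z, hz, rfl⟩, rfl⟩
        exact ⟨_, ⟨z, hz, rfl⟩, (hσ z hz).symm⟩
      · rintro ⟨_, ⟨z, hz, rfl⟩, rfl⟩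
        exact ⟨_, ⟨z, hz, rfl⟩, hσ z hz⟩
    have hrefl : (∀ z ∈ B, g * diagHom k z * g⁻¹ = diagHom k z) → B' = B := by
      intro h
      have := hmap (MulEquiv.refl _) h
      rw [this]
      exact Subgroup.map_id B
    by_cases hB : ∀ z ∈ B, z.1 = z.2
    · exact Or.inl (hrefl fun z hz => conj_diagHom_of_eq g (hB z hz))
    · push Not at hB
      obtain ⟨x, hx, hne⟩ := hB
      have h1 : g * diagHom k x * g⁻¹ ∈ B'.map (diagHom k) := by
        rw [← hg]
        exact ⟨_, ⟨x, hx, rfl⟩, rfl⟩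
      obtain ⟨y, -, hy⟩ := h1
      rcases conj_diagHom_eq_or_swap hne hy.symm with h | h
      · exact Or.inl (hrefl fun z _ => h z)
      · exact Or.inr (hmap MulEquiv.prodComm fun z _ => h z)
  · rintro (rfl | rfl)
    · refine ⟨1, ?_⟩
      ext x
      simp
    · obtain ⟨w, hw⟩ := exists_conj_diagHom_swap (k := k)
      refine ⟨w, ?_⟩
      rw [Subgroup.swapProd, Subgroup.map_map, Subgroup.map_map]
      congr 1
      ext1 x
      exact hw x

end DiagonalTorus

/-! ### Abelian subgroups of order prime to p -/

/-- A subgroup of `GL₂` that is conjugate to a group of diagonal matrices. -/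
def Subgroup.IsSplit {k : Type*} [Field k] (H : Subgroup (GL (Fin 2) k)) : Prop :=
  ∃ g : GL (Fin 2) k, ∀ h ∈ H, g * h * g⁻¹ ∈ (diagHom k).range

theorem Subgroup.coe_pow_eq_one_of_card {n k : Type*} [Fintype n] [DecidableEq n] [Field k]
    {H : Subgroup (GL n k)} {m : ℕ} (hm : Nat.card H = m) {h : GL n k} (hh : h ∈ H) :
    (h : Matrix n n k) ^ m = 1 := by
  have : (⟨h, hh⟩ : H) ^ m = 1 := hm ▸ pow_card_eq_one'
  have h2 : h ^ m = 1 := congrArg Subtype.val this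
  rw [← Units.val_pow_eq_pow_val, h2, Units.val_one]

/-- A conjugation relation between matrices, read in the general linear group. -/
theorem commute_conj {n k : Type*} [Fintype n] [DecidableEq n] [Field k] {g h h' : GL n k}
    {D : Matrix n n k} (hg : g.1 * h.1 = D * g.1) (hc : h * h' = h' * h) :
    D * (g * h' * g⁻¹).1 = (g * h' * g⁻¹).1 * D := by
  have hD : D = (g * h * g⁻¹).1 := by
    rw [Units.val_mul, Units.val_mul, hg, mul_assoc, Units.mul_inv, mul_one]
  rw [hD, ← Units.val_mul, ← Units.val_mul]
  congr 1
  calc _ = g * (h * h') * g⁻¹ := by group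
    _ = _ := by rw [hc]; group

section NonSplit

variable {p : ℕ} [Fact p.Prime]

/-- Being abelian, H lies in the centralizer of any nonscalar h in it. If the characteristic
polynomial of h has a root, its roots are distinct and this centralizer is a split torus, contrary
to hypothesis; otherwise it is a nonsplit torus. -/
theorem Subgroup.exists_conj_le_range_quadHom {m : ℕ} (hm : (m : ZMod p) ≠ 0)
    {H : Subgroup (GL (Fin 2) (ZMod p))} (hH : Nat.card H = m)
    (hcomm : ∀ a ∈ H, ∀ b ∈ H, a * b = b * a) (hns : ¬ H.IsSplit) :
    ∃ g : GL (Fin 2) (ZMod p), ∀ h ∈ H, g * h * g⁻¹ ∈ (quadHom p).range := by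
  by_cases hall : ∀ h ∈ H, ¬ h.1.NonScalar
  · refine absurd ⟨1, fun h hh => ?_⟩ hns
    simpa using mem_range_diagHom_of_not_nonScalar (hall h hh)
  push Not at hall
  obtain ⟨h, hh, hn⟩ := hall
  by_cases hroot : ∃ l : ZMod p, l * l = h.1.trace * l - h.1.det
  · obtain ⟨l, hl⟩ := hroot
    have hne := hn.root_ne hm (coe_pow_eq_one_of_card hH hh) hl
    obtain ⟨g, hg⟩ := hn.exists_conj_diagonal hl hne
    refine absurd ⟨g, fun h' hh' => ?_⟩ hns
    exact mem_range_diagHom_of_commute hne (commute_conj hg (hcomm h hh h' hh'))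
  · push Not at hroot
    obtain ⟨g, x, hx, hg⟩ := hn.exists_conj_quadMul hroot
    refine ⟨g, fun h' hh' => ?_⟩
    exact mem_range_quadHom_of_commute hx (commute_conj hg (hcomm h hh h' hh'))

theorem Subgroup.exists_map_quadHom_eq {m : ℕ} (hm : (m : ZMod p) ≠ 0)
    {H : Subgroup (GL (Fin 2) (ZMod p))} (hH : Nat.card H = m)
    (hcomm : ∀ a ∈ H, ∀ b ∈ H, a * b = b * a) (hns : ¬ H.IsSplit) :
    ∃ (g : GL (Fin 2) (ZMod p)) (U : Subgroup (GaloisField p 2)ˣ), Nat.card U = m ∧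
      H.map (MulAut.conj g).toMonoidHom = U.map (quadHom p) := by
  obtain ⟨g, hg⟩ := exists_conj_le_range_quadHom hm hH hcomm hns
  have hle : H.map (MulAut.conj g).toMonoidHom ≤ (quadHom p).range := by
    rintro _ ⟨h, hh, rfl⟩
    exact hg h hh
  refine ⟨g, (H.map (MulAut.conj g).toMonoidHom).comap (quadHom p), ?_, ?_⟩
  · rw [← hH, ← card_map_of_injective (K := H) (f := (MulAut.conj g).toMonoidHom)
      (MulEquiv.injective _), ← card_map_of_injective quadHom_injective,
      map_comap_eq_self hle]
  · rw [map_comap_eq_self hle]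

theorem Subgroup.card_dvd_of_not_isSplit {m : ℕ} (hm : (m : ZMod p) ≠ 0)
    {H : Subgroup (GL (Fin 2) (ZMod p))} (hH : Nat.card H = m)
    (hcomm : ∀ a ∈ H, ∀ b ∈ H, a * b = b * a) (hns : ¬ H.IsSplit) :
    m ∣ p ^ 2 - 1 ∧ ¬ m ∣ p - 1 := by
  obtain ⟨g, U, hU, hg⟩ := exists_map_quadHom_eq hm hH hcomm hns
  refine ⟨by rw [← hU, ← GaloisField.card_units_two]; exact U.card_subgroup_dvd_card, ?_⟩
  intro hdvd
  refine hns ⟨g, fun h hh => ?_⟩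
  have h1 : g * h * g⁻¹ ∈ U.map (quadHom p) := by
    rw [← hg]
    exact ⟨h, hh, rfl⟩
  obtain ⟨u, hu, hu'⟩ := h1
  rw [← hu']
  apply mem_range_diagHom_of_not_nonScalar
  rw [coe_quadHom, nonScalar_quadMul_iff]
  push Not
  -- If m ∣ p - 1, every u in U satisfies u ^ p = u, so it lies in the prime field and acts as a
  -- scalar; H would then be split.
  apply GaloisField.exists_algebraMap_eq
  have h2 : u ^ m = 1 := by
    have : (⟨u, hu⟩ : U) ^ m = 1 := hU ▸ pow_card_eq_one'
    exact congrArg Subtype.val this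
  have h3 : u ^ (p - 1) = 1 := by
    obtain ⟨c, hc⟩ := hdvd
    rw [hc, pow_mul, h2, one_pow]
  have h4 := pow_succ u (p - 1)
  rw [Nat.sub_add_cancel (Fact.out : p.Prime).one_le, h3, one_mul] at h4
  exact congrArg Units.val h4

theorem Subgroup.exists_conj_of_not_isSplit {m : ℕ} (hm : (m : ZMod p) ≠ 0)
    {H H' : Subgroup (GL (Fin 2) (ZMod p))} (hH : Nat.card H = m)
    (hcomm : ∀ a ∈ H, ∀ b ∈ H, a * b = b * a) (hns : ¬ H.IsSplit) (hH' : Nat.card H' = m)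
    (hcomm' : ∀ a ∈ H', ∀ b ∈ H', a * b = b * a) (hns' : ¬ H'.IsSplit) :
    ∃ g : GL (Fin 2) (ZMod p), H.map (MulAut.conj g).toMonoidHom = H' := by
  obtain ⟨g, U, hU, hg⟩ := exists_map_quadHom_eq hm hH hcomm hns
  obtain ⟨g', U', hU', hg'⟩ := exists_map_quadHom_eq hm hH' hcomm' hns'
  have hUU : U = U' := IsCyclic.subgroup_eq_of_card_eq (hU.trans hU'.symm)
  refine ⟨g'⁻¹ * g, ?_⟩
  have h1 : H'.map (MulAut.conj g').toMonoidHom = H.map (MulAut.conj g).toMonoidHom := by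
    rw [hg, hg', hUU]
  apply map_injective (f := (MulAut.conj g').toMonoidHom) (MulEquiv.injective _)
  rw [h1, map_map]
  congr 1
  ext1 x
  simp [mul_assoc]

/-- Take the group generated by a unit of order m. Diagonal matrices over `ZMod p` are killed by p -
1, so splitting would force m ∣ p - 1. -/
theorem exists_not_isSplit {m : ℕ} (h1 : m ∣ p ^ 2 - 1) (h2 : ¬ m ∣ p - 1) :
    ∃ H : Subgroup (GL (Fin 2) (ZMod p)), Nat.card H = m ∧
      (∀ a ∈ H, ∀ b ∈ H, a * b = b * a) ∧ ¬ H.IsSplit := by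
  rw [← GaloisField.card_units_two] at h1
  obtain ⟨u, hu⟩ := IsCyclic.exists_orderOf_eq h1
  refine ⟨(Subgroup.zpowers u).map (quadHom p), ?_, ?_, ?_⟩
  · rw [Subgroup.card_map_of_injective quadHom_injective, Nat.card_zpowers, hu]
  · rintro _ ⟨a, -, rfl⟩ _ ⟨b, -, rfl⟩
    rw [← map_mul, mul_comm, map_mul]
  · rintro ⟨g, hg⟩
    obtain ⟨x, hx⟩ := hg _ ⟨u, Subgroup.mem_zpowers u, rfl⟩
    apply h2
    rw [← hu, orderOf_dvd_iff_pow_eq_one]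
    apply quadHom_injective
    have h3 : x ^ (p - 1) = 1 := by
      ext1 <;> exact ZMod.units_pow_card_sub_one_eq_one p _
    have h4 := congrArg (· ^ (p - 1)) hx
    rw [← map_pow, h3, map_one, conj_pow, eq_comm, conj_eq_one_iff] at h4
    rw [map_pow, h4, map_one]

end NonSplit

/-! ### Abstract groups of order qr and dihedral generators -/

theorem isMulCommutative_of_zpowers_le_center {G : Type*} [Group G] [Finite G] {h : G} {q : ℕ}
    (hq : q.Prime) (hcard : Nat.card G = q * orderOf h) (hc : ∀ t, t * h = h * t) (a b : G) :
    a * b = b * a := by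
  have hle : Subgroup.zpowers h ≤ Subgroup.center G := by
    rw [Subgroup.zpowers_le, Subgroup.mem_center_iff]
    exact hc
  have hnorm : (Subgroup.zpowers h).Normal :=
    ⟨fun n hn g => by rwa [Subgroup.mem_center_iff.1 (hle hn) g, mul_inv_cancel_right]⟩
  have hpos : 0 < orderOf h := orderOf_pos h
  have hquot : Nat.card (G ⧸ Subgroup.zpowers h) = q := by
    have := (Subgroup.zpowers h).card_eq_card_quotient_mul_card_subgroup
    rw [hcard, Nat.card_zpowers] at this
    exact (Nat.eq_of_mul_eq_mul_right hpos this).symm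
  have := Fact.mk hq
  have := isCyclic_of_prime_card hquot
  have h2 := (QuotientGroup.mk' (Subgroup.zpowers h)).isMulCommutative_of_isCyclic_of_ker_le_center
    (by rwa [QuotientGroup.ker_mk'])
  exact h2.is_comm.comm a b

theorem exists_orderOf_conj_mem_zpowers {G : Type*} [Group G] [Finite G] {q r : ℕ} (hq : q.Prime)
    (hr : r.Prime) (hqr : q < r) (hcard : Nat.card G = q * r) :
    ∃ h : G, orderOf h = r ∧ ∀ t : G, t * h * t⁻¹ ∈ Subgroup.zpowers h := by
  have := Fact.mk hr
  obtain ⟨h, hh⟩ := exists_prime_orderOf_dvd_card' (G := G) r (hcard ▸ Dvd.intro_left _ rfl)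
  have hidx : (Subgroup.zpowers h).index = (Nat.card G).minFac := by
    have h1 := (Subgroup.zpowers h).index_mul_card
    rw [Nat.card_zpowers, hh, hcard] at h1
    have h2 := Nat.eq_of_mul_eq_mul_right hr.pos h1
    have h3 : (q * r).minFac ≤ q := Nat.minFac_le_of_dvd hq.two_le (Dvd.intro _ rfl)
    have h4 : (q * r).minFac.Prime := Nat.minFac_prime
      fun h => hq.ne_one (Nat.dvd_one.1 (Dvd.intro _ h))
    rw [h2, hcard]
    rcases (h4.dvd_mul).1 (Nat.minFac_dvd (q * r)) with h5 | h5
    · exact ((Nat.prime_dvd_prime_iff_eq h4 hq).1 h5).symm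
    · rw [(Nat.prime_dvd_prime_iff_eq h4 hr).1 h5] at h3
      omega
  have hnorm := Subgroup.normal_of_index_eq_minFac_card hidx
  exact ⟨h, hh, fun t => hnorm.conj_mem h (Subgroup.mem_zpowers h) t⟩

/-- The set ⟨h⟩ ∪ t⟨h⟩ is a subgroup containing the closure, which bounds the order above by 2r.
Both 2 and r divide the order, which bounds it below. -/
theorem card_closure_pair {G : Type*} [Group G] {h t : G} {r : ℕ} (hr : r.Prime) (hr2 : r ≠ 2)
    (hh : orderOf h = r) (ht : t * t = 1) (hconj : t * h * t⁻¹ = h⁻¹) :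
    t * h ≠ h * t ∧ Nat.card (Subgroup.closure {h, t}) = 2 * r := by
  have hne : t * h ≠ h * t := by
    intro hc
    rw [hc, mul_inv_cancel_right] at hconj
    have h2 : h ^ 2 = 1 := by rw [sq]; nth_rewrite 2 [hconj]; exact mul_inv_cancel h
    have h3 := orderOf_dvd_of_pow_eq_one h2
    rw [hh, Nat.prime_dvd_prime_iff_eq hr Nat.prime_two] at h3
    exact hr2 h3
  refine ⟨hne, ?_⟩
  have hz : ∀ i : ℤ, h ^ i * t = t * h ^ (-i) := by
    intro i
    rw [zpow_neg, ← inv_zpow, ← hconj, conj_zpow, ← mul_assoc, ← mul_assoc, ht, one_mul]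
    congr 1
    exact eq_inv_of_mul_eq_one_left ht
  let D : Subgroup G :=
    { carrier := {x | ∃ i : ℤ, x = h ^ i ∨ x = t * h ^ i}
      one_mem' := ⟨0, Or.inl (by simp)⟩
      mul_mem' := by
        rintro _ _ ⟨i, rfl | rfl⟩ ⟨j, rfl | rfl⟩
        · exact ⟨i + j, Or.inl (by rw [zpow_add])⟩
        · exact ⟨-i + j, Or.inr (by rw [← mul_assoc, hz, mul_assoc, ← zpow_add])⟩
        · exact ⟨i + j, Or.inr (by rw [mul_assoc, ← zpow_add])⟩
        · refine ⟨-i + j, Or.inl ?_⟩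
          rw [mul_assoc, ← mul_assoc (h ^ i), hz, mul_assoc, ← zpow_add, ← mul_assoc, ht, one_mul]
      inv_mem' := by
        rintro _ ⟨i, rfl | rfl⟩
        · exact ⟨-i, Or.inl (by rw [zpow_neg])⟩
        · refine ⟨i, Or.inr ?_⟩
          rw [mul_inv_rev, ← zpow_neg, ← eq_inv_of_mul_eq_one_left ht, hz, neg_neg] }
  have hle : Subgroup.closure {h, t} ≤ D := by
    rw [Subgroup.closure_le]
    rintro _ (rfl | rfl)
    · exact ⟨1, Or.inl (by simp)⟩
    · exact ⟨0, Or.inr (by simp)⟩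
  have hD : (D : Set G) = (Subgroup.zpowers h : Set G) ∪ (fun x => t * x) '' Subgroup.zpowers h := by
    ext x
    constructor
    · rintro ⟨i, rfl | rfl⟩
      · exact Or.inl ⟨i, rfl⟩
      · exact Or.inr ⟨_, ⟨i, rfl⟩, rfl⟩
    · rintro (⟨i, rfl⟩ | ⟨_, ⟨i, rfl⟩, rfl⟩)
      · exact ⟨i, Or.inl rfl⟩
      · exact ⟨i, Or.inr rfl⟩
  have hz : (Subgroup.zpowers h : Set G).ncard = r := by
    rw [← Nat.card_coe_set_eq]
    exact (Nat.card_zpowers h).trans hh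
  have hfin : (Subgroup.zpowers h : Set G).Finite := Set.finite_of_ncard_pos (hz ▸ hr.pos)
  have hDfin : (D : Set G).Finite := by
    rw [hD]
    exact hfin.union (hfin.image _)
  have : Finite D := hDfin
  have : Finite (Subgroup.closure {h, t}) := Set.Finite.subset hDfin hle
  have hcD : Nat.card D ≤ 2 * r := by
    change Nat.card (D : Set G) ≤ _
    rw [Nat.card_coe_set_eq, hD]
    refine (Set.ncard_union_le _ _).trans ?_
    have := Set.ncard_image_le (f := fun x => t * x) hfin
    omega
  have h1 : Nat.card (Subgroup.closure {h, t}) ≤ 2 * r :=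
    (Subgroup.card_le_of_le hle).trans hcD
  have ho2 : orderOf t = 2 := by
    apply orderOf_eq_prime (by rw [sq, ht])
    rintro rfl
    exact hne (by simp)
  have h2 : 2 ∣ Nat.card (Subgroup.closure {h, t}) := by
    rw [← ho2]
    exact Subgroup.orderOf_dvd_natCard _ (Subgroup.subset_closure (by simp))
  have h3 : r ∣ Nat.card (Subgroup.closure {h, t}) := by
    rw [← hh]
    exact Subgroup.orderOf_dvd_natCard _ (Subgroup.subset_closure (by simp))
  have h4 := Nat.Coprime.mul_dvd_of_dvd_of_dvd
    ((Nat.coprime_primes Nat.prime_two hr).2 (Ne.symm hr2)) h2 h3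
  exact le_antisymm h1 (Nat.le_of_dvd Nat.card_pos h4)

/-! ### Elements normalizing a semisimple element -/

section Normalizing

variable {k : Type*} [Field k]

/-- The conjugate commutes with h, so it is x + y h, with the trace and determinant of h. These
force y = 1 or y = -1, because the discriminant of h is nonzero by semisimplicity. -/
theorem conj_eq_or_of_commute (h2 : (2 : k) ≠ 0) {h t : GL (Fin 2) k} (hn : h.1.NonScalar)
    {m : ℕ} (hm : (m : k) ≠ 0) (hpow : h.1 ^ m = 1)
    (hc : h * (t * h * t⁻¹) = (t * h * t⁻¹) * h) :
    t * h * t⁻¹ = h ∨ (t * h * t⁻¹).1 = h.1.trace • 1 - h.1 := by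
  obtain ⟨x, y, hxy⟩ := hn.exists_of_commute (M := (t * h * t⁻¹).1)
    (by rw [← Units.val_mul, ← Units.val_mul, hc])
  have htr : (t * h * t⁻¹).1.trace = h.1.trace := by
    rw [Units.val_mul, Units.val_mul, Matrix.trace_mul_comm, ← mul_assoc, Units.inv_mul, one_mul]
  have hdet : (t * h * t⁻¹).1.det = h.1.det := by
    rw [Units.val_mul, Units.val_mul, Matrix.det_mul, Matrix.det_mul, mul_right_comm,
      ← Matrix.det_mul, Units.mul_inv, Matrix.det_one, one_mul]
  rw [hxy] at htr hdet
  have e1 : 2 * x + y * h.1.trace = h.1.trace := by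
    rw [Matrix.trace_fin_two] at htr
    simp at htr
    rw [Matrix.trace_fin_two] at htr ⊢
    linear_combination htr
  have e2 : x ^ 2 + x * y * h.1.trace + y ^ 2 * h.1.det = h.1.det := by
    rw [Matrix.det_fin_two] at hdet
    simp at hdet
    rw [Matrix.trace_fin_two]
    rw [Matrix.det_fin_two] at hdet ⊢
    linear_combination hdet
  -- Completing the square in `e2` gives (2x + y tr)² + y² (4 det - tr²) = 4 det, and `e1` says that
  -- 2x + y tr = tr.
  have e3 : (1 - y) * (1 + y) * (4 * h.1.det - h.1.trace ^ 2) = 0 := by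
    linear_combination (-4) * e2 + (2 * x + (1 - y) * h.1.trace + 2 * y * h.1.trace) * e1
  have e4 : 4 * h.1.det - h.1.trace ^ 2 ≠ 0 := by
    intro e4
    apply hn.root_ne hm hpow (l := h.1.trace / 2)
    · field_simp
      linear_combination e4
    · field_simp
      ring
  rcases mul_eq_zero.1 ((mul_eq_zero.1 e3).resolve_right e4) with hy | hy
  · left
    have hy' : y = 1 := by linear_combination -hy
    subst hy'
    have hx : x = 0 := by
      have : 2 * x = 0 := by linear_combination e1
      exact (mul_eq_zero.1 this).resolve_left h2
    apply Units.ext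
    rw [hxy, hx]
    simp
  · right
    have hy' : y = -1 := by linear_combination hy
    subst hy'
    have hx : x = h.1.trace := by
      have : 2 * (x - h.1.trace) = 0 := by linear_combination e1
      exact sub_eq_zero.1 ((mul_eq_zero.1 this).resolve_left h2)
    rw [hxy, hx, neg_smul, one_smul, sub_eq_add_neg]

theorem commute_of_not_nonScalar {h : GL (Fin 2) k} (hn : ¬ h.1.NonScalar) (t : GL (Fin 2) k) :
    t * h = h * t := by
  rw [Matrix.not_nonScalar_iff] at hn
  apply Units.ext
  rw [Units.val_mul, Units.val_mul, hn, mul_smul_comm, smul_mul_assoc, mul_one, one_mul]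

theorem commute_of_odd_order (h2 : (2 : k) ≠ 0) {h t : GL (Fin 2) k} {m : ℕ} (hm : (m : k) ≠ 0)
    (hodd : Odd m) (hpow : h.1 ^ m = 1) (htpow : t ^ m = 1)
    (hc : h * (t * h * t⁻¹) = (t * h * t⁻¹) * h) : t * h = h * t := by
  by_cases hn : h.1.NonScalar
  · rcases conj_eq_or_of_commute h2 hn hm hpow hc with h1 | h1
    · exact mul_inv_eq_iff_eq_mul.1 h1
    -- The map h ↦ tr h - h is an involution, so t² commutes with h; as t has odd order it is a
    -- power of t².
    · have h3 : t ^ 2 * h * (t ^ 2)⁻¹ = h := by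
        have e : t ^ 2 * h * (t ^ 2)⁻¹ = t * (t * h * t⁻¹) * t⁻¹ := by
          rw [sq, mul_inv_rev]
          simp only [mul_assoc]
        rw [e]
        apply Units.ext
        rw [Units.val_mul, Units.val_mul, h1, mul_sub, sub_mul, mul_smul_comm, mul_one,
          smul_mul_assoc, Units.mul_inv, ← Units.val_mul, ← Units.val_mul, h1]
        abel
      have h4 : Commute (t ^ 2) h := mul_inv_eq_iff_eq_mul.1 h3
      obtain ⟨j, rfl⟩ := hodd
      have h5 : t = (t ^ 2) ^ (j + 1) := by
        rw [← pow_mul, show 2 * (j + 1) = 2 * j + 1 + 1 by ring, pow_succ, htpow, one_mul]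
      rw [h5]
      exact h4.pow_left _
  · exact commute_of_not_nonScalar hn t

end Normalizing

variable {p : ℕ} [Fact p.Prime]

theorem ZMod.two_ne_zero_of_ne (hp : p ≠ 2) : (2 : ZMod p) ≠ 0 := by
  intro h
  have : ((2 : ℕ) : ZMod p) = 0 := by exact_mod_cast h
  rw [ZMod.natCast_eq_zero_iff, Nat.prime_dvd_prime_iff_eq Fact.out Nat.prime_two] at this
  exact hp this

theorem commute_of_card_odd_prime_mul (hp : p ≠ 2) {q r : ℕ} (hq : q.Prime) (hr : r.Prime)
    (hqp : q ≠ p) (hrp : r ≠ p) (hq2 : 2 < q) (hqr : q < r) {H : Subgroup (GL (Fin 2) (ZMod p))}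
    (hH : Nat.card H = q * r) : ∀ a ∈ H, ∀ b ∈ H, a * b = b * a := by
  obtain ⟨h, hh, hconj⟩ := exists_orderOf_conj_mem_zpowers hq hr hqr hH
  have hm : ((q * r : ℕ) : ZMod p) ≠ 0 := by
    rw [Ne, ZMod.natCast_eq_zero_iff, (Fact.out : p.Prime).dvd_mul,
      Nat.prime_dvd_prime_iff_eq Fact.out hq, Nat.prime_dvd_prime_iff_eq Fact.out hr]
    rintro (h | h)
    · exact hqp h.symm
    · exact hrp h.symm
  have hodd : Odd (q * r) :=
    (hq.odd_of_ne_two hq2.ne').mul (hr.odd_of_ne_two (hq2.trans hqr).ne')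
  have hc : ∀ t : H, t * h = h * t := by
    intro t
    apply Subtype.ext
    apply commute_of_odd_order (ZMod.two_ne_zero_of_ne hp) hm hodd
      (Subgroup.coe_pow_eq_one_of_card hH h.2)
    · exact Units.ext (Subgroup.coe_pow_eq_one_of_card hH t.2)
    · obtain ⟨i, hi⟩ := hconj t
      have : h * (t * h * t⁻¹) = t * h * t⁻¹ * h := by
        rw [← hi]
        exact (Commute.refl h).zpow_right i
      exact congrArg Subtype.val this
  intro a ha b hb
  have := isMulCommutative_of_zpowers_le_center hq (by rw [hH, hh]) hc ⟨a, ha⟩ ⟨b, hb⟩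
  exact congrArg Subtype.val this

/-! ### Dihedral subgroups: normal form, eigenvalues, existence and conjugacy -/

/-- Generators of a dihedral subgroup of order `2 * r` in `GL₂`, the rotation having
determinant one. -/
structure IsDihedralPair {k : Type*} [Field k] (r : ℕ) (h t : GL (Fin 2) k) : Prop where
  orderOf_eq : orderOf h = r
  mul_self : t * t = 1
  conj : t * h * t⁻¹ = h⁻¹
  det_eq : h.1.det = 1

namespace IsDihedralPair

variable {k : Type*} [Field k] {r : ℕ} {h t : GL (Fin 2) k}

theorem not_commute (hp : IsDihedralPair r h t) (hr : r.Prime) (hr2 : r ≠ 2) :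
    t * h ≠ h * t :=
  (card_closure_pair hr hr2 hp.orderOf_eq hp.mul_self hp.conj).1

theorem nonScalar (hp : IsDihedralPair r h t) (hr : r.Prime) (hr2 : r ≠ 2) : h.1.NonScalar := by
  by_contra hn
  exact hp.not_commute hr hr2 (commute_of_not_nonScalar hn t)

theorem pow_eq_one (hp : IsDihedralPair r h t) : h.1 ^ r = 1 := by
  have := pow_orderOf_eq_one h
  rw [hp.orderOf_eq] at this
  rw [← Units.val_pow_eq_pow_val, this, Units.val_one]

theorem pow (hp : IsDihedralPair r h t) (hr : r.Prime) {n : ℕ} (hn : h ^ n ≠ 1) :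
    IsDihedralPair r (h ^ n) t where
  orderOf_eq := by
    have := Fact.mk hr
    refine orderOf_eq_prime ?_ hn
    rw [← pow_mul, mul_comm, pow_mul, ← hp.orderOf_eq, pow_orderOf_eq_one, one_pow]
  mul_self := hp.mul_self
  conj := by rw [← conj_pow, hp.conj, inv_pow]
  det_eq := by rw [Units.val_pow_eq_pow_val, Matrix.det_pow, hp.det_eq, one_pow]

/-- The reflection t is a nonscalar involution, hence conjugate to diag(1, -1). The relation hth = t
and det h = 1 then force equal diagonal entries for h, and a diagonal change of basis makes its
upper right entry 1. Only the trace of h remains as a parameter. -/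
theorem exists_conj_standard (hp : IsDihedralPair r h t) (hr : r.Prime) (hr2 : r ≠ 2)
    (h2 : (2 : k) ≠ 0) (hrk : (r : k) ≠ 0) :
    ∃ g : GL (Fin 2) k, g.1 * t.1 = !![1, 0; 0, -1] * g.1 ∧
      g.1 * h.1 = !![h.1.trace / 2, 1; (h.1.trace / 2) ^ 2 - 1, h.1.trace / 2] * g.1 := by
  have hnc := hp.not_commute hr hr2
  have htn : t.1.NonScalar := by
    by_contra hn
    exact hnc (commute_of_not_nonScalar hn h).symm
  have ht := Matrix.mul_self_fin_two t.1
  rw [← Units.val_mul, hp.mul_self, Units.val_one] at ht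
  have htr : t.1.trace = 0 := by
    by_contra h0
    apply Matrix.not_nonScalar_smul_one (t.1.trace⁻¹ * (1 + t.1.det))
    have : t.1.trace • t.1 = (1 + t.1.det) • (1 : Matrix (Fin 2) (Fin 2) k) := by
      rw [add_smul, one_smul]
      exact (eq_sub_iff_add_eq.1 ht).symm
    rw [mul_smul, ← this, smul_smul, inv_mul_cancel₀ h0, one_smul]
    exact htn
  have hdet : t.1.det = -1 := by
    rw [htr, zero_smul, zero_sub] at ht
    have := congrFun (congrFun ht 0) 0
    simp at this
    linear_combination this
  have h11 : (1 : k) ≠ -1 := by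
    intro h
    apply h2
    linear_combination h
  obtain ⟨g, hg⟩ := htn.exists_conj
    (show (!![1, 0; 0, -1] : Matrix (Fin 2) (Fin 2) k).NonScalar from Or.inr (Or.inr h11))
    (by simp [htr, Matrix.trace_fin_two]) (by simp [hdet, Matrix.det_fin_two])
  set M := (g * h * g⁻¹).1 with hM
  have hgh : g.1 * h.1 = M * g.1 := by
    rw [hM, ← Units.val_mul, ← Units.val_mul]
    congr 1
    group
  have hgt : (g * t * g⁻¹).1 = !![1, 0; 0, -1] := by
    rw [Units.val_mul, Units.val_mul, hg, mul_assoc, Units.mul_inv, mul_one]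
  have hMT : M * !![1, 0; 0, -1] * M = !![1, 0; 0, -1] := by
    rw [← hgt, hM, ← Units.val_mul, ← Units.val_mul]
    congr 1
    have : h * t * h = t := by
      have := hp.conj
      rw [mul_inv_eq_iff_eq_mul] at this
      rw [mul_assoc, this, ← mul_assoc, mul_inv_cancel, one_mul]
    calc _ = g * (h * t * h) * g⁻¹ := by group
      _ = _ := by rw [this]
  have hMdet : M.det = 1 := by
    rw [hM, Units.val_mul, Units.val_mul, Matrix.det_mul, Matrix.det_mul, mul_right_comm,
      ← Matrix.det_mul, Units.mul_inv, Matrix.det_one, one_mul, hp.det_eq]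
  have hMtr : M.trace = h.1.trace := by
    rw [hM, Units.val_mul, Units.val_mul, Matrix.trace_mul_comm, ← mul_assoc, Units.inv_mul,
      one_mul]
  have hMn : M.NonScalar := (hp.nonScalar hr hr2).of_mul_eq g hgh
  have hMpow : M ^ r = 1 := by
    rw [hM, ← Units.val_pow_eq_pow_val, conj_pow, ← hp.orderOf_eq, pow_orderOf_eq_one]
    simp
  clear_value M
  have e := fun i j => congrFun (congrFun hMT i) j
  have e00 := e 0 0
  have e01 := e 0 1
  have e10 := e 1 0
  simp [Matrix.mul_apply, Fin.sum_univ_two] at e00 e01 e10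
  rw [Matrix.det_fin_two] at hMdet
  rw [Matrix.trace_fin_two] at hMtr
  have hdiag : M 0 0 = M 1 1 := by
    by_contra hne
    have hne' : M 0 0 - M 1 1 ≠ 0 := sub_ne_zero.2 hne
    have h0 : M 0 0 = 0 := by
      have : (M 0 0 - M 1 1) * M 0 0 = 0 := by linear_combination e00 - hMdet
      exact (mul_eq_zero.1 this).resolve_left hne'
    have h1 : M 0 1 = 0 := by
      have : (M 0 0 - M 1 1) * M 0 1 = 0 := by linear_combination e01
      exact (mul_eq_zero.1 this).resolve_left hne'
    rw [h0, h1] at hMdet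
    simp at hMdet
  have ha : M 0 0 = h.1.trace / 2 := by
    rw [← hMtr, ← hdiag]
    field_simp
    ring
  -- Otherwise M is triangular with equal diagonal entries, giving a double eigenvalue.
  have hb : M 0 1 ≠ 0 := by
    intro hb
    apply hMn.root_ne hrk hMpow (l := M 0 0)
    · rw [Matrix.det_fin_two, Matrix.trace_fin_two, hb]
      ring
    · rw [Matrix.trace_fin_two, hdiag]
      ring
  -- Conjugation by diag(1, b) divides the upper right entry by b and fixes diag(1, -1).
  let d : GL (Fin 2) k := Matrix.GeneralLinearGroup.mkOfDetNeZero !![1, 0; 0, M 0 1]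
    (by simpa [Matrix.det_fin_two_of] using hb)
  have hd : d.1 = !![1, 0; 0, M 0 1] := rfl
  refine ⟨d * g, ?_, ?_⟩
  · rw [Units.val_mul, mul_assoc, hg, ← mul_assoc, ← mul_assoc]
    congr 1
    rw [hd]
    simp
  · rw [Units.val_mul, mul_assoc, hgh, ← mul_assoc, ← mul_assoc]
    congr 1
    rw [hd, ← ha]
    ext i j
    fin_cases i <;> fin_cases j <;> simp [Matrix.mul_apply, Fin.sum_univ_two]
    · rw [← hdiag] at hMdet
      linear_combination -hMdet
    · rw [hdiag]; ring

end IsDihedralPair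

section Eigenvalues

variable {p : ℕ} [Fact p.Prime]

/-- Over the field with p² elements h is diagonalizable with eigenvalues x and x⁻¹, since its
determinant is 1. Tracking the traces of all powers allows generators of two rotation groups to be
matched. -/
theorem IsDihedralPair.exists_eigenvalue {r : ℕ} {h t : GL (Fin 2) (ZMod p)}
    (hp : IsDihedralPair r h t) (hr : r.Prime) (hr2 : r ≠ 2) (hrp : (r : ZMod p) ≠ 0) :
    ∃ x : (GaloisField p 2)ˣ, orderOf x = r ∧ ∀ n : ℕ,
      algebraMap (ZMod p) (GaloisField p 2) (h ^ n).1.trace =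
        (x ^ n : (GaloisField p 2)ˣ) + ((x ^ n)⁻¹ : (GaloisField p 2)ˣ) := by
  set φ := algebraMap (ZMod p) (GaloisField p 2) with hφ
  have hφi : Function.Injective φ := φ.injective
  obtain ⟨a, ha⟩ := GaloisField.exists_quadratic_root p h.1.trace h.1.det
  rw [hp.det_eq, map_one, ← hφ] at ha
  let A : Matrix (Fin 2) (Fin 2) (GaloisField p 2) := φ.mapMatrix h.1
  have hAtr : A.trace = φ h.1.trace := by
    simp [A, Matrix.trace_fin_two]
  have hAdet : A.det = 1 := by
    rw [← RingHom.map_det, hp.det_eq, map_one]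
  have hAn : A.NonScalar := by
    rcases hp.nonScalar hr hr2 with h1 | h1 | h1
    · exact Or.inl (by simpa [A] using h1)
    · exact Or.inr (Or.inl (by simpa [A] using h1))
    · exact Or.inr (Or.inr fun e => h1 (hφi e))
  have hApow : A ^ r = 1 := by rw [← map_pow, hp.pow_eq_one, map_one]
  have hrK : (r : GaloisField p 2) ≠ 0 := by
    rw [← map_natCast φ]
    exact (map_ne_zero φ).2 hrp
  have hroot : a * a = A.trace * a - A.det := by rw [hAtr, hAdet, ha]
  have hne := hAn.root_ne hrK hApow hroot
  obtain ⟨g, hg⟩ := hAn.exists_conj_diagonal hroot hne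
  have hmul : a * (A.trace - a) = 1 := by
    rw [hAdet] at hroot
    linear_combination -hroot
  let x : (GaloisField p 2)ˣ := ⟨a, A.trace - a, hmul, by rw [mul_comm, hmul]⟩
  have hgd : g.1 * A = (diagHom _ (x, x⁻¹)).1 * g.1 := hg
  have hgn : ∀ n : ℕ, A ^ n = (g⁻¹).1 * (diagHom _ (x ^ n, (x ^ n)⁻¹)).1 * g.1 := by
    intro n
    have h1 : (diagHom _ (x ^ n, (x ^ n)⁻¹)) = (diagHom (GaloisField p 2) (x, x⁻¹)) ^ n := by
      rw [← map_pow, Prod.pow_mk, inv_pow]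
    have h2 : A = (g⁻¹ * diagHom _ (x, x⁻¹) * g).1 := by
      rw [Units.val_mul, Units.val_mul, mul_assoc, ← hgd, ← mul_assoc, Units.inv_mul, one_mul]
    have h3 := conj_pow (a := g⁻¹) (b := diagHom _ (x, x⁻¹)) (i := n)
    rw [inv_inv] at h3
    rw [h2, ← Units.val_pow_eq_pow_val, h3, h1]
    rfl
  have hxr : x ^ r = 1 := by
    have h1 := hgn r
    rw [hApow] at h1
    have h2 : (1 : GL (Fin 2) (GaloisField p 2)) = g⁻¹ * diagHom _ (x ^ r, (x ^ r)⁻¹) * g :=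
      Units.ext h1
    have h3 : diagHom _ (x ^ r, (x ^ r)⁻¹) = (1 : GL (Fin 2) (GaloisField p 2)) := by
      calc _ = g * (g⁻¹ * diagHom _ (x ^ r, (x ^ r)⁻¹) * g) * g⁻¹ := by group
        _ = _ := by rw [← h2]; group
    rw [← map_one (diagHom (GaloisField p 2))] at h3
    exact congrArg Prod.fst (diagHom_injective h3)
  have hx1 : x ≠ 1 := by
    intro h1
    have h2 : a = 1 := congrArg Units.val h1
    apply hne
    rw [h2, one_mul] at hmul
    rw [h2, hmul]
  have := Fact.mk hr
  refine ⟨x, orderOf_eq_prime hxr hx1, fun n => ?_⟩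
  have h1 : φ (h ^ n).1.trace = (A ^ n).trace := by
    rw [Units.val_pow_eq_pow_val, ← map_pow]
    simp [Matrix.trace_fin_two]
  rw [h1, hgn, Matrix.trace_mul_comm, ← mul_assoc, Units.mul_inv, one_mul, coe_diagHom,
    Matrix.trace_fin_two_of]

theorem IsDihedralPair.dvd {r : ℕ} {h t : GL (Fin 2) (ZMod p)}
    (hp : IsDihedralPair r h t) (hr : r.Prime) (hr2 : r ≠ 2) (hrp : (r : ZMod p) ≠ 0) :
    r ∣ p ^ 2 - 1 := by
  obtain ⟨x, hx, -⟩ := hp.exists_eigenvalue hr hr2 hrp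
  rw [← GaloisField.card_units_two, ← hx]
  exact orderOf_dvd_natCard x

/-- The eigenvalues x and y generate the same subgroup of a cyclic group, so some y ^ n is x. Then
h' ^ n has the trace of h, the two pairs share a standard form, and replacing h' by h' ^ n does not
change the dihedral group. -/
theorem IsDihedralPair.exists_conj_closure {r : ℕ} {h t h' t' : GL (Fin 2) (ZMod p)}
    (hp : IsDihedralPair r h t) (hp' : IsDihedralPair r h' t') (hr : r.Prime) (hr2 : r ≠ 2)
    (hrp : (r : ZMod p) ≠ 0) (h2 : (2 : ZMod p) ≠ 0) :
    ∃ g : GL (Fin 2) (ZMod p), (Subgroup.closure {h, t}).map (MulAut.conj g).toMonoidHom =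
      Subgroup.closure {h', t'} := by
  obtain ⟨x, hx, hxt⟩ := hp.exists_eigenvalue hr hr2 hrp
  obtain ⟨y, hy, hyt⟩ := hp'.exists_eigenvalue hr hr2 hrp
  have hxy : Subgroup.zpowers y = Subgroup.zpowers x := by
    apply IsCyclic.subgroup_eq_of_card_eq
    rw [Nat.card_zpowers, Nat.card_zpowers, hx, hy]
  obtain ⟨n, hn⟩ : ∃ n : ℕ, y ^ n = x := by
    have : x ∈ Subgroup.zpowers y := hxy ▸ Subgroup.mem_zpowers x
    rwa [← mem_powers_iff_mem_zpowers] at this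
  have htr : (h' ^ n).1.trace = h.1.trace := by
    apply (algebraMap (ZMod p) (GaloisField p 2)).injective
    have := hxt 1
    rw [pow_one, pow_one] at this
    rw [hyt, hn, this]
  have hn1 : h' ^ n ≠ 1 := by
    intro h1
    have h3 : y ^ n = 1 := by
      rw [← orderOf_dvd_iff_pow_eq_one, hy, ← hp'.orderOf_eq]
      exact orderOf_dvd_of_pow_eq_one h1
    rw [h3] at hn
    rw [← hn, orderOf_one] at hx
    exact hr.ne_one hx.symm
  have hp'' := hp'.pow hr hn1
  obtain ⟨g, hg1, hg2⟩ := hp.exists_conj_standard hr hr2 h2 hrp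
  obtain ⟨g', hg1', hg2'⟩ := hp''.exists_conj_standard hr hr2 h2 hrp
  rw [htr] at hg2'
  have key : ∀ {u v : GL (Fin 2) (ZMod p)} {D : Matrix (Fin 2) (Fin 2) (ZMod p)},
      g.1 * u.1 = D * g.1 → g'.1 * v.1 = D * g'.1 → g'⁻¹ * g * u * (g'⁻¹ * g)⁻¹ = v := by
    intro u v D hu hv
    have hv' : D = (g' * v * g'⁻¹).1 := by
      rw [Units.val_mul, Units.val_mul, hv, mul_assoc, Units.mul_inv, mul_one]
    rw [hv', ← Units.val_mul, ← Units.val_mul] at hu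
    have hu' : g * u = g' * v * g'⁻¹ * g := Units.ext hu
    rw [mul_inv_eq_iff_eq_mul, mul_assoc, hu']
    group
  have hcl : Subgroup.closure {h' ^ n, t'} = Subgroup.closure {h', t'} := by
    have h1 := (card_closure_pair hr hr2 hp''.orderOf_eq hp''.mul_self hp''.conj).2
    have h3 := (card_closure_pair hr hr2 hp'.orderOf_eq hp'.mul_self hp'.conj).2
    apply Subgroup.eq_of_le_of_card_ge
    · rw [Subgroup.closure_le]
      rintro _ (rfl | rfl)
      · exact pow_mem (Subgroup.subset_closure (by simp)) n
      · exact Subgroup.subset_closure (by simp)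
    · rw [h1, h3]
  refine ⟨g'⁻¹ * g, ?_⟩
  rw [MonoidHom.map_closure, Set.image_pair, ← hcl]
  congr 1
  congr 1
  · exact key hg2 hg2'
  · exact congrArg _ (key hg1 hg1')

end Eigenvalues

section Dihedral

variable {p : ℕ} [Fact p.Prime]

/-- Frobenius inverts x if r ∣ p + 1 and fixes x if r ∣ p - 1; in both cases it fixes x + x⁻¹. -/
theorem exists_algebraMap_eq_add_inv {r : ℕ} (hr : r.Prime) (hdvd : r ∣ p ^ 2 - 1)
    {x : (GaloisField p 2)ˣ} (hx : orderOf x = r) :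
    ∃ c : ZMod p, algebraMap (ZMod p) (GaloisField p 2) c = x + (x⁻¹ : (GaloisField p 2)ˣ) := by
  apply GaloisField.exists_algebraMap_eq
  have hp1 : 1 ≤ p := (Fact.out : p.Prime).one_le
  rw [add_pow_char, ← Units.val_pow_eq_pow_val, ← Units.val_pow_eq_pow_val]
  have h1 : p ^ 2 - 1 = (p + 1) * (p - 1) := by
    have := Nat.sq_sub_sq p 1
    rwa [one_pow] at this
  rw [h1, hr.dvd_mul] at hdvd
  rcases hdvd with h | h
  · have h2 : x ^ p = x⁻¹ := by
      rw [eq_inv_iff_mul_eq_one, ← pow_succ, ← orderOf_dvd_iff_pow_eq_one, hx]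
      exact h
    rw [inv_pow, h2, inv_inv, add_comm]
  · have h2 : x ^ p = x := by
      have h3 := pow_succ x (p - 1)
      rw [Nat.sub_add_cancel hp1] at h3
      rw [h3, orderOf_dvd_iff_pow_eq_one.1 (hx ▸ h), one_mul]
    rw [inv_pow, h2]

/-- The standard form with trace x + x⁻¹, for x of order r, is written down over `ZMod p`;
diagonalizing it over the quadratic extension shows that its r-th power is 1. -/
theorem exists_isDihedralPair (h2 : (2 : ZMod p) ≠ 0) {r : ℕ} (hr : r.Prime) (hr2 : r ≠ 2)
    (hdvd : r ∣ p ^ 2 - 1) : ∃ h t : GL (Fin 2) (ZMod p), IsDihedralPair r h t := by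
  obtain ⟨x, hx⟩ := IsCyclic.exists_orderOf_eq (C := (GaloisField p 2)ˣ) (n := r)
    (by rwa [GaloisField.card_units_two])
  obtain ⟨c, hc⟩ := exists_algebraMap_eq_add_inv hr hdvd hx
  set φ := algebraMap (ZMod p) (GaloisField p 2) with hφ
  have hφi : Function.Injective φ := φ.injective
  let h : GL (Fin 2) (ZMod p) := Matrix.GeneralLinearGroup.mkOfDetNeZero
    !![c / 2, 1; (c / 2) ^ 2 - 1, c / 2] (by
      rw [Matrix.det_fin_two_of]
      intro h0
      apply one_ne_zero (α := ZMod p)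
      linear_combination h0)
  have hh : h.1 = !![c / 2, 1; (c / 2) ^ 2 - 1, c / 2] := rfl
  have hdet : h.1.det = 1 := by
    rw [hh, Matrix.det_fin_two_of]
    ring
  have htr : h.1.trace = c := by
    rw [hh, Matrix.trace_fin_two_of]
    field_simp
    ring
  let t : GL (Fin 2) (ZMod p) := diagHom _ (1, -1)
  have ht : t.1 = !![1, 0; 0, -1] := by
    rw [coe_diagHom]
    simp
  let A : Matrix (Fin 2) (Fin 2) (GaloisField p 2) := φ.mapMatrix h.1
  have hAtr : A.trace = x + (x⁻¹ : (GaloisField p 2)ˣ) := by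
    rw [← hc, ← htr]
    simp [A, Matrix.trace_fin_two]
  have hAdet : A.det = 1 := by
    rw [← RingHom.map_det, hdet, map_one]
  have hAn : A.NonScalar := Or.inl (by simp [A, hh])
  have hne : (x : GaloisField p 2) ≠ A.trace - x := by
    rw [hAtr, add_sub_cancel_left]
    intro h0
    have h1 : x = x⁻¹ := Units.ext h0
    have h3 : x ^ 2 = 1 := by rw [sq, ← mul_inv_cancel x, ← h1]
    have h4 := orderOf_dvd_of_pow_eq_one h3
    rw [hx, Nat.prime_dvd_prime_iff_eq hr Nat.prime_two] at h4
    exact hr2 h4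
  obtain ⟨g, hg⟩ := hAn.exists_conj_diagonal (l := x)
    (by rw [hAtr, hAdet, add_mul, Units.inv_mul]; ring) hne
  have hD : (!![(x : GaloisField p 2), 0; 0, A.trace - x] : Matrix (Fin 2) (Fin 2) _) =
      (diagHom _ (x, x⁻¹)).1 := by
    rw [coe_diagHom, hAtr, add_sub_cancel_left]
  have hAr : A ^ r = 1 := by
    have h1 : A = (g⁻¹ * diagHom _ (x, x⁻¹) * g).1 := by
      rw [Units.val_mul, Units.val_mul, mul_assoc, ← hD, ← hg, ← mul_assoc, Units.inv_mul, one_mul]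
    have h3 := conj_pow (a := g⁻¹) (b := diagHom _ (x, x⁻¹)) (i := r)
    have hxr : x ^ r = 1 := hx ▸ pow_orderOf_eq_one x
    rw [inv_inv, ← map_pow, Prod.pow_mk, inv_pow, hxr, inv_one, Prod.mk_one_one, map_one, mul_one,
      inv_mul_cancel] at h3
    rw [h1, ← Units.val_pow_eq_pow_val, h3, Units.val_one]
  refine ⟨h, t, ?_, ?_, ?_, hdet⟩
  · have := Fact.mk hr
    apply orderOf_eq_prime
    · apply Units.ext
      rw [Units.val_pow_eq_pow_val, Units.val_one]
      have h1 : φ.mapMatrix (h.1 ^ r) =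
          φ.mapMatrix (1 : Matrix (Fin 2) (Fin 2) (ZMod p)) := by
        rw [map_pow, map_one]
        exact hAr
      exact Matrix.ext fun i j => hφi (congrFun (congrFun h1 i) j)
    · intro h1
      have h3 : h.1 0 1 = (1 : Matrix (Fin 2) (Fin 2) (ZMod p)) 0 1 := by rw [h1, Units.val_one]
      simp [hh] at h3
  · apply Units.ext
    rw [Units.val_mul, ht, Units.val_one]
    simp [Matrix.one_fin_two]
  · rw [mul_inv_eq_iff_eq_mul, eq_inv_mul_iff_mul_eq]
    apply Units.ext
    rw [Units.val_mul, Units.val_mul, ht, hh]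
    ext i j
    fin_cases i <;> fin_cases j <;> simp [Matrix.mul_apply, Fin.sum_univ_two] <;> ring

/-- Let h generate the normal subgroup of order r and t be an involution. As t does not fix h, it
sends h to tr h - h, so the product of this conjugate with h is the scalar det h. This product is
also a power of h, and it must be 1, which yields both inversion and det h = 1. -/
theorem exists_isDihedralPair_of_not_commute (h2 : (2 : ZMod p) ≠ 0) {r : ℕ} (hr : r.Prime)
    (hr2 : r ≠ 2) (hrp : (r : ZMod p) ≠ 0) {H : Subgroup (GL (Fin 2) (ZMod p))}
    (hH : Nat.card H = 2 * r) (hnc : ¬ ∀ a ∈ H, ∀ b ∈ H, a * b = b * a) :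
    ∃ h t, IsDihedralPair r h t ∧ Subgroup.closure {h, t} = H := by
  have hr3 : 2 < r := lt_of_le_of_ne hr.two_le (Ne.symm hr2)
  obtain ⟨h, hh, hconj⟩ := exists_orderOf_conj_mem_zpowers Nat.prime_two hr hr3 hH
  obtain ⟨t, ht⟩ := exists_prime_orderOf_dvd_card' (G := H) 2 (hH ▸ Dvd.intro _ rfl)
  have hncen : ¬ ∀ s : H, s * h = h * s := by
    intro hc
    apply hnc
    intro a ha b hb
    have := isMulCommutative_of_zpowers_le_center Nat.prime_two (by rw [hH, hh]) hc ⟨a, ha⟩ ⟨b, hb⟩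
    exact congrArg Subtype.val this
  have hth : t * h ≠ h * t := by
    intro hc
    apply hncen
    have h1 : r ∣ Nat.card (Subgroup.centralizer {h}) := by
      rw [← hh]
      exact Subgroup.orderOf_dvd_natCard _ (Subgroup.mem_centralizer_singleton_iff.2 rfl)
    have h3 : 2 ∣ Nat.card (Subgroup.centralizer {h}) := by
      exact ht.symm.dvd.trans
        (Subgroup.orderOf_dvd_natCard _ (Subgroup.mem_centralizer_singleton_iff.2 hc))
    have h4 := Nat.Coprime.mul_dvd_of_dvd_of_dvd
      ((Nat.coprime_primes Nat.prime_two hr).2 (Ne.symm hr2)) h3 h1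
    have h5 : Subgroup.centralizer {h} = ⊤ := by
      apply Subgroup.eq_top_of_le_card
      rw [hH]
      exact Nat.le_of_dvd Nat.card_pos h4
    intro s
    have : s ∈ Subgroup.centralizer {h} := h5 ▸ Subgroup.mem_top s
    exact Subgroup.mem_centralizer_singleton_iff.1 this
  have hth' : t.1 * h.1 ≠ h.1 * t.1 := fun e => hth (Subtype.ext e)
  have hn : h.1.1.NonScalar := by
    by_contra hn
    exact hth' (commute_of_not_nonScalar hn t.1)
  have hhr : orderOf h.1 = r := by rw [Subgroup.orderOf_coe, hh]
  have hpow : h.1.1 ^ r = 1 := by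
    have : h.1 ^ r = 1 := hhr ▸ pow_orderOf_eq_one h.1
    rw [← Units.val_pow_eq_pow_val, this, Units.val_one]
  have htt : t.1 * t.1 = 1 := by
    have : t ^ 2 = 1 := orderOf_dvd_iff_pow_eq_one.1 ht.dvd
    rw [sq] at this
    exact congrArg Subtype.val this
  obtain ⟨i, hi⟩ := hconj t
  have hi' : h.1 ^ i = t.1 * h.1 * t.1⁻¹ := congrArg Subtype.val hi
  have hadj := (conj_eq_or_of_commute h2 hn hrp hpow (t := t.1)
    (by rw [← hi']; exact (Commute.refl h.1).zpow_right i)).resolve_left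
      fun e => hth' (mul_inv_eq_iff_eq_mul.1 e)
  have hs : (h.1 ^ i * h.1).1 = h.1.1.det • (1 : Matrix (Fin 2) (Fin 2) (ZMod p)) := by
    rw [Units.val_mul, hi', hadj, sub_mul, Matrix.mul_self_fin_two, smul_mul_assoc, one_mul]
    abel
  have hsn : ¬ (h.1 ^ i * h.1).1.NonScalar := by
    rw [hs]
    exact Matrix.not_nonScalar_smul_one _
  -- A nontrivial power would generate ⟨h⟩, making h a power of a scalar and hence central.
  have hs1 : h.1 ^ i * h.1 = 1 := by
    by_contra hs1
    have := Fact.mk hr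
    have hso : orderOf (h.1 ^ i * h.1) = r := by
      refine orderOf_eq_prime ?_ hs1
      rw [← zpow_add_one, ← zpow_natCast, ← zpow_mul, mul_comm, zpow_mul, zpow_natCast, ← hhr,
        pow_orderOf_eq_one, one_zpow]
    have hz : Subgroup.zpowers (h.1 ^ i * h.1) = Subgroup.zpowers h.1 := by
      apply Subgroup.eq_of_le_of_card_ge
      · rw [Subgroup.zpowers_le, ← zpow_add_one]
        exact ⟨i + 1, rfl⟩
      · rw [Nat.card_zpowers, Nat.card_zpowers, hso, hhr]
    obtain ⟨j, hj⟩ : h.1 ∈ Subgroup.zpowers (h.1 ^ i * h.1) := hz ▸ Subgroup.mem_zpowers h.1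
    apply hth'
    have hcomm : Commute t.1 (h.1 ^ i * h.1) := commute_of_not_nonScalar hsn t.1
    have := hcomm.zpow_right j
    dsimp only at hj
    rwa [hj] at this
  have hpair : IsDihedralPair r h.1 t.1 := by
    refine ⟨hhr, htt, ?_, ?_⟩
    · rw [← hi']
      exact eq_inv_of_mul_eq_one_left hs1
    · rw [hs1, Units.val_one] at hs
      have := congrFun (congrFun hs 0) 0
      simpa using this.symm
  refine ⟨h.1, t.1, hpair, ?_⟩
  apply Subgroup.eq_of_le_of_card_ge
  · rw [Subgroup.closure_le]
    rintro _ (rfl | rfl)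
    · exact h.2
    · exact t.2
  · rw [(card_closure_pair hr hr2 hhr htt hpair.conj).2, hH]

end Dihedral

/-! ### The three kinds of classes and their numbers -/

/-- All elements of the subgroup commute with each other. -/
def Subgroup.PairwiseCommute {G : Type*} [Group G] (H : Subgroup G) : Prop :=
  ∀ a ∈ H, ∀ b ∈ H, a * b = b * a

theorem Subgroup.PairwiseCommute.of_conj {G : Type*} [Group G] {H K : Subgroup G} {g : G}
    (h : H.map (MulAut.conj g).toMonoidHom = K) (hK : K.PairwiseCommute) : H.PairwiseCommute := by
  intro a ha b hb
  have h1 := hK (MulAut.conj g a) (h ▸ ⟨a, ha, rfl⟩) (MulAut.conj g b) (h ▸ ⟨b, hb, rfl⟩)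
  rw [← map_mul, ← map_mul] at h1
  exact (MulAut.conj g).injective h1

theorem Subgroup.IsSplit.of_conj {k : Type*} [Field k] {H K : Subgroup (GL (Fin 2) k)}
    {g : GL (Fin 2) k} (h : H.map (MulAut.conj g).toMonoidHom = K) (hK : K.IsSplit) :
    H.IsSplit := by
  obtain ⟨w, hw⟩ := hK
  refine ⟨w * g, fun a ha => ?_⟩
  have h1 := hw (MulAut.conj g a) (h ▸ ⟨a, ha, rfl⟩)
  rw [MulAut.conj_apply] at h1
  convert h1 using 1
  group

theorem Subgroup.isSplit_map_diagHom {k : Type*} [Field k] (B : Subgroup (kˣ × kˣ)) :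
    (B.map (diagHom k)).IsSplit := by
  refine ⟨1, ?_⟩
  rintro _ ⟨x, -, rfl⟩
  exact ⟨x, by simp⟩

theorem Subgroup.pairwiseCommute_map_diagHom {k : Type*} [Field k] (B : Subgroup (kˣ × kˣ)) :
    (B.map (diagHom k)).PairwiseCommute := by
  rintro _ ⟨x, -, rfl⟩ _ ⟨y, -, rfl⟩
  rw [← map_mul, mul_comm, map_mul]

theorem Subgroup.IsSplit.exists_map_diagHom_eq {k : Type*} [Field k] {H : Subgroup (GL (Fin 2) k)}
    (h : H.IsSplit) : ∃ (B : Subgroup (kˣ × kˣ)) (g : GL (Fin 2) k),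
      (B.map (diagHom k)).map (MulAut.conj g).toMonoidHom = H := by
  obtain ⟨g, hg⟩ := h
  have hle : H.map (MulAut.conj g).toMonoidHom ≤ (diagHom k).range := by
    rintro _ ⟨h, hh, rfl⟩
    exact hg h hh
  refine ⟨(H.map (MulAut.conj g).toMonoidHom).comap (diagHom k), g⁻¹, ?_⟩
  rw [map_comap_eq_self hle, map_map]
  convert map_id H using 2
  ext1 x
  simp [mul_assoc]

/-- The conjugacy classes of nonabelian subgroups of order `m`. -/
def nonabelianClasses (m : ℕ) (G : Type*) [Group G] : Set (Quotient (subgroupConjSetoid G m)) :=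
  {c | ∃ H, Quotient.mk _ H = c ∧ ¬ H.1.PairwiseCommute}

theorem ncard_nonabelianClasses_eq_zero {m : ℕ} {G : Type*} [Group G]
    (h : ∀ H : Subgroup G, Nat.card H = m → H.PairwiseCommute) :
    (nonabelianClasses m G).ncard = 0 := by
  have : nonabelianClasses m G = ∅ := by
    apply Set.eq_empty_iff_forall_notMem.2
    rintro _ ⟨H, -, hH⟩
    exact hH (h H.1 H.2)
  rw [this, Set.ncard_empty]

section Classes

variable {p : ℕ} [Fact p.Prime]

/-- The conjugacy classes of abelian subgroups of order `m` that are not diagonalizable. -/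
def nonsplitClasses (p m : ℕ) [Fact p.Prime] :
    Set (Quotient (subgroupConjSetoid (GL (Fin 2) (ZMod p)) m)) :=
  {c | ∃ H, Quotient.mk _ H = c ∧ H.1.PairwiseCommute ∧ ¬ H.1.IsSplit}

/-- The class of the group of diagonal matrices attached to a subgroup of the torus. -/
def splitClass (p m : ℕ) [Fact p.Prime]
    (B : {B : Subgroup ((ZMod p)ˣ × (ZMod p)ˣ) // Nat.card B = m}) :
    Quotient (subgroupConjSetoid (GL (Fin 2) (ZMod p)) m) :=
  Quotient.mk _ ⟨B.1.map (diagHom (ZMod p)),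
    (Subgroup.card_map_of_injective diagHom_injective).trans B.2⟩

theorem numSubgroupClasses_eq_add (m : ℕ) :
    numSubgroupClasses m (GL (Fin 2) (ZMod p)) = (Set.range (splitClass p m)).ncard +
      (nonsplitClasses p m).ncard + (nonabelianClasses m (GL (Fin 2) (ZMod p))).ncard := by
  have hd1 : Disjoint (Set.range (splitClass p m)) (nonsplitClasses p m) := by
    rw [Set.disjoint_left]
    rintro _ ⟨B, rfl⟩ ⟨H, hH, -, hns⟩
    obtain ⟨g, hg⟩ := Quotient.exact hH
    exact hns (Subgroup.IsSplit.of_conj hg (Subgroup.isSplit_map_diagHom B.1))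
  have hd2 : Disjoint (Set.range (splitClass p m) ∪ nonsplitClasses p m)
      (nonabelianClasses m (GL (Fin 2) (ZMod p))) := by
    rw [Set.disjoint_left]
    rintro _ (⟨B, rfl⟩ | ⟨K, rfl, hK, -⟩) ⟨H, hH, hn⟩
    · obtain ⟨g, hg⟩ := Quotient.exact hH
      exact hn (Subgroup.PairwiseCommute.of_conj hg (Subgroup.pairwiseCommute_map_diagHom B.1))
    · obtain ⟨g, hg⟩ := Quotient.exact hH
      exact hn (Subgroup.PairwiseCommute.of_conj hg hK)
  have hu : Set.range (splitClass p m) ∪ nonsplitClasses p m ∪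
      nonabelianClasses m (GL (Fin 2) (ZMod p)) = Set.univ := by
    apply Set.eq_univ_of_forall
    intro c
    induction c using Quotient.inductionOn with | h H => ?_
    by_cases hc : H.1.PairwiseCommute
    · by_cases hs : H.1.IsSplit
      · left; left
        obtain ⟨B, g, hg⟩ := hs.exists_map_diagHom_eq
        have hB : Nat.card B = m := by
          rw [← H.2, ← hg, Subgroup.card_map_of_injective (MulEquiv.injective _),
            Subgroup.card_map_of_injective diagHom_injective]
        exact ⟨⟨B, hB⟩, Quotient.sound ⟨g, hg⟩⟩
      · left; right
        exact ⟨H, rfl, hc, hs⟩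
    · right
      exact ⟨H, rfl, hc⟩
  rw [numSubgroupClasses, ← Set.ncard_univ, ← hu, Set.ncard_union_eq hd2, Set.ncard_union_eq hd1]

theorem two_mul_ncard_range_splitClass (m : ℕ) :
    2 * (Set.range (splitClass p m)).ncard =
      {B : Subgroup ((ZMod p)ˣ × (ZMod p)ˣ) | Nat.card B = m}.ncard +
        {B : Subgroup ((ZMod p)ˣ × (ZMod p)ˣ) | Nat.card B = m ∧ B.swapProd = B}.ncard := by
  let σ : {B : Subgroup ((ZMod p)ˣ × (ZMod p)ˣ) // Nat.card B = m} →
      {B : Subgroup ((ZMod p)ˣ × (ZMod p)ˣ) // Nat.card B = m} :=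
    fun B => ⟨B.1.swapProd, (Subgroup.card_swapProd B.1).trans B.2⟩
  have hσ : Function.Involutive σ := by
    intro B
    apply Subtype.ext
    ext x
    simp only [σ, Subgroup.mem_swapProd, Prod.swap_swap]
  rw [two_mul_ncard_range_of_involutive σ hσ (splitClass p m)]
  · congr 1
    rw [← Set.ncard_image_of_injective _ Subtype.val_injective]
    congr 1
    ext B
    constructor
    · rintro ⟨B, hB, rfl⟩
      exact ⟨B.2, congrArg Subtype.val hB⟩
    · rintro ⟨h1, h2⟩
      exact ⟨⟨B, h1⟩, Subtype.ext h2, rfl⟩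
  · intro B B'
    rw [splitClass, splitClass, Quotient.eq]
    refine (exists_conj_map_diagHom_iff B.1 B'.1).trans ?_
    simp only [σ, Subtype.ext_iff]

open Classical in
theorem ncard_nonsplitClasses {m : ℕ} (hm : (m : ZMod p) ≠ 0) :
    (nonsplitClasses p m).ncard = if m ∣ p ^ 2 - 1 ∧ ¬ m ∣ p - 1 then 1 else 0 := by
  split_ifs with h
  · obtain ⟨H, hH, hc, hs⟩ := exists_not_isSplit h.1 h.2
    rw [Set.ncard_eq_one]
    refine ⟨Quotient.mk _ ⟨H, hH⟩, ?_⟩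
    ext c
    rw [Set.mem_singleton_iff]
    constructor
    · rintro ⟨K, rfl, hKc, hKs⟩
      exact Quotient.sound (Subgroup.exists_conj_of_not_isSplit hm K.2 hKc hKs hH hc hs)
    · rintro rfl
      exact ⟨_, rfl, hc, hs⟩
  · have : nonsplitClasses p m = ∅ := by
      apply Set.eq_empty_iff_forall_notMem.2
      rintro _ ⟨H, -, hc, hs⟩
      exact h (Subgroup.card_dvd_of_not_isSplit hm H.2 hc hs)
    rw [this, Set.ncard_empty]

open Classical in
theorem two_mul_numSubgroupClasses {m : ℕ} (hm : (m : ZMod p) ≠ 0) :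
    2 * numSubgroupClasses m (GL (Fin 2) (ZMod p)) =
      {B : Subgroup ((ZMod p)ˣ × (ZMod p)ˣ) | Nat.card B = m}.ncard +
        {B : Subgroup ((ZMod p)ˣ × (ZMod p)ˣ) | Nat.card B = m ∧ B.swapProd = B}.ncard +
      2 * (if m ∣ p ^ 2 - 1 ∧ ¬ m ∣ p - 1 then 1 else 0) +
      2 * (nonabelianClasses m (GL (Fin 2) (ZMod p))).ncard := by
  rw [numSubgroupClasses_eq_add, mul_add, mul_add, two_mul_ncard_range_splitClass,
    ncard_nonsplitClasses hm]

open Classical in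
theorem ncard_nonabelianClasses_two_mul (h2 : (2 : ZMod p) ≠ 0) {r : ℕ} (hr : r.Prime)
    (hr2 : r ≠ 2) (hrp : (r : ZMod p) ≠ 0) :
    (nonabelianClasses (2 * r) (GL (Fin 2) (ZMod p))).ncard =
      if r ∣ p ^ 2 - 1 then 1 else 0 := by
  split_ifs with h
  · obtain ⟨a, t, hat⟩ := exists_isDihedralPair h2 hr hr2 h
    obtain ⟨hnc, hcard⟩ := card_closure_pair hr hr2 hat.orderOf_eq hat.mul_self hat.conj
    rw [Set.ncard_eq_one]
    refine ⟨Quotient.mk _ ⟨_, hcard⟩, ?_⟩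
    ext c
    rw [Set.mem_singleton_iff]
    constructor
    · rintro ⟨K, rfl, hK⟩
      obtain ⟨a', t', hat', hcl⟩ :=
        exists_isDihedralPair_of_not_commute h2 hr hr2 hrp K.2 hK
      refine Quotient.sound ?_
      have := hat'.exists_conj_closure hat hr hr2 hrp h2
      rw [hcl] at this
      exact this
    · rintro rfl
      refine ⟨_, rfl, fun hc => hnc ?_⟩
      exact hc t (Subgroup.subset_closure (by simp)) a (Subgroup.subset_closure (by simp))
  · have : nonabelianClasses (2 * r) (GL (Fin 2) (ZMod p)) = ∅ := by
      apply Set.eq_empty_iff_forall_notMem.2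
      rintro _ ⟨H, -, hc⟩
      obtain ⟨a, t, hat, -⟩ := exists_isDihedralPair_of_not_commute h2 hr hr2 hrp H.2 hc
      exact h (hat.dvd hr hr2 hrp)
    rw [this, Set.ncard_empty]

end Classes

/-! ### Evaluating the count for each order -/

theorem Subgroup.PairwiseCommute.of_card_prime {G : Type*} [Group G] {q : ℕ} (hq : q.Prime)
    {H : Subgroup G} (hH : Nat.card H = q) : H.PairwiseCommute := by
  have := Fact.mk hq
  have := isCyclic_of_prime_card hH
  intro a ha b hb
  have h := (IsCyclic.isMulCommutative (α := H)).is_comm.comm ⟨a, ha⟩ ⟨b, hb⟩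
  exact congrArg Subtype.val h

theorem Subgroup.PairwiseCommute.of_card_prime_sq {G : Type*} [Group G] {q : ℕ} (hq : q.Prime)
    {H : Subgroup G} (hH : Nat.card H = q ^ 2) : H.PairwiseCommute := by
  have := Fact.mk hq
  intro a ha b hb
  exact congrArg Subtype.val
    ((IsPGroup.isMulCommutative_of_card_eq_prime_sq hH).is_comm.comm ⟨a, ha⟩ ⟨b, hb⟩)

theorem Nat.Prime.not_dvd_add_one_of_dvd_sub_one {q p : ℕ} (hq2 : 2 < q) (hp : 1 ≤ p)
    (h : q ∣ p - 1) : ¬ q ∣ p + 1 := by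
  intro h'
  have h1 := Nat.dvd_sub h' h
  rw [show p + 1 - (p - 1) = 2 by omega] at h1
  have := Nat.le_of_dvd two_pos h1
  omega

theorem Nat.sq_sub_one_eq (p : ℕ) : p ^ 2 - 1 = (p + 1) * (p - 1) := by
  have := Nat.sq_sub_sq p 1
  rwa [one_pow] at this

section Arithmetic

variable {p : ℕ} [Fact p.Prime]

theorem ZMod.natCast_prime_ne_zero {q : ℕ} (hq : q.Prime) (hqp : q ≠ p) : (q : ZMod p) ≠ 0 := by
  rw [Ne, ZMod.natCast_eq_zero_iff, Nat.prime_dvd_prime_iff_eq Fact.out hq]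
  exact hqp.symm

theorem card_units_zmod : Nat.card (ZMod p)ˣ = p - 1 := by
  rw [Nat.card_eq_fintype_card, ZMod.card_units]

theorem two_dvd_sub_one (hp : p ≠ 2) : 2 ∣ p - 1 := by
  have := (Fact.out : p.Prime).odd_of_ne_two hp
  obtain ⟨j, rfl⟩ := this
  simp

theorem ncard_swap_fixed_eq_zero {m : ℕ}
    (h : {B : Subgroup ((ZMod p)ˣ × (ZMod p)ˣ) | Nat.card B = m} = ∅) :
    {B : Subgroup ((ZMod p)ˣ × (ZMod p)ˣ) | Nat.card B = m ∧ B.swapProd = B}.ncard = 0 := by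
  have : {B : Subgroup ((ZMod p)ˣ × (ZMod p)ˣ) | Nat.card B = m ∧ B.swapProd = B} = ∅ :=
    Set.eq_empty_iff_forall_notMem.2 fun B hB => Set.eq_empty_iff_forall_notMem.1 h B hB.1
  rw [this, Set.ncard_empty]

theorem ncard_swap_fixed_prime_sq_of_not_dvd {q : ℕ} (hq : q.Prime) (h : q ∣ p - 1)
    (h' : ¬ q ^ 2 ∣ p - 1) :
    {B : Subgroup ((ZMod p)ˣ × (ZMod p)ˣ) | Nat.card B = q ^ 2 ∧ B.swapProd = B}.ncard = 1 := by
  rw [← card_units_zmod] at h h'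
  rw [Set.ncard_eq_one]
  refine ⟨torsionProd _ q, ?_⟩
  ext B
  have h1 := Set.ext_iff.1 (setOf_card_eq_prime_sq_of_not_dvd hq h h') B
  simp only [Set.mem_ofPred_eq, Set.mem_singleton_iff] at h1 ⊢
  rw [h1]
  exact ⟨fun h => h.1, fun h => ⟨h, h ▸ swapProd_torsionProd q⟩⟩

theorem numSubgroupClasses_two (hp : p ≠ 2) :
    numSubgroupClasses 2 (GL (Fin 2) (ZMod p)) = 2 := by
  classical
  have hd := two_dvd_sub_one hp
  have h := two_mul_numSubgroupClasses (p := p) (m := 2)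
    (ZMod.natCast_prime_ne_zero Nat.prime_two hp.symm)
  rw [ncard_nonabelianClasses_eq_zero fun H => Subgroup.PairwiseCommute.of_card_prime Nat.prime_two,
    if_neg fun h => h.2 hd, ncard_card_eq_prime Nat.prime_two (by rwa [card_units_zmod]),
    ncard_card_eq_swap_fixed_of_squarefree Nat.prime_two.squarefree (by rwa [card_units_zmod])] at h
  have h1 : {k : ZMod 2 | k ^ 2 = 1}.ncard = 1 := by
    rw [Set.ncard_eq_toFinset_card']
    decide
  omega

theorem numSubgroupClasses_prime {q : ℕ} (hq : q.Prime) (hqp : q ≠ p) (hq2 : 2 < q) :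
    (numSubgroupClasses q (GL (Fin 2) (ZMod p)) : ℚ) =
      ((q : ℚ) + 3) / 2 * divInd (p - 1) q + divInd (p + 1) q := by
  classical
  have hp1 : 1 ≤ p := (Fact.out : p.Prime).one_le
  have h := two_mul_numSubgroupClasses (p := p) (m := q) (ZMod.natCast_prime_ne_zero hq hqp)
  rw [ncard_nonabelianClasses_eq_zero fun H => Subgroup.PairwiseCommute.of_card_prime hq] at h
  by_cases hd : q ∣ p - 1
  · rw [if_neg fun h => h.2 hd, ncard_card_eq_prime hq (by rwa [card_units_zmod]),
      ncard_card_eq_swap_fixed_of_squarefree hq.squarefree (by rwa [card_units_zmod]),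
      ncard_sq_eq_one_of_prime hq hq2.ne'] at h
    rw [divInd, divInd, if_pos hd, if_neg (Nat.Prime.not_dvd_add_one_of_dvd_sub_one hq2 hp1 hd)]
    have h' : (2 : ℚ) * numSubgroupClasses q (GL (Fin 2) (ZMod p)) = q + 1 + 2 := by
      exact_mod_cast h
    linarith
  · have he : {B : Subgroup ((ZMod p)ˣ × (ZMod p)ˣ) | Nat.card B = q} = ∅ :=
      setOf_card_eq_of_not_dvd hq dvd_rfl (by rwa [card_units_zmod])
    have hiff : (q ∣ p ^ 2 - 1 ∧ ¬ q ∣ p - 1) ↔ q ∣ p + 1 := by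
      rw [Nat.sq_sub_one_eq, hq.dvd_mul]
      tauto
    rw [ncard_swap_fixed_eq_zero he, he, Set.ncard_empty] at h
    simp only [hiff] at h
    rw [divInd, divInd, if_neg hd]
    split_ifs at h ⊢
    · have : numSubgroupClasses q (GL (Fin 2) (ZMod p)) = 1 := by omega
      rw [this]; norm_num
    · have : numSubgroupClasses q (GL (Fin 2) (ZMod p)) = 0 := by omega
      rw [this]; norm_num

theorem numSubgroupClasses_four (hp : p ≠ 2) :
    (numSubgroupClasses 4 (GL (Fin 2) (ZMod p)) : ℚ) = 2 + 3 * divInd (p - 1) 4 := by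
  classical
  have h4 : (4 : ℕ) = 2 ^ 2 := rfl
  have hd := two_dvd_sub_one hp
  have h := two_mul_numSubgroupClasses (p := p) (m := 4) (by
    rw [h4, Nat.cast_pow]
    exact pow_ne_zero _ (ZMod.natCast_prime_ne_zero Nat.prime_two hp.symm))
  have hna : (nonabelianClasses 4 (GL (Fin 2) (ZMod p))).ncard = 0 :=
    ncard_nonabelianClasses_eq_zero
      fun H => Subgroup.PairwiseCommute.of_card_prime_sq Nat.prime_two
  rw [hna] at h
  by_cases hd4 : 4 ∣ p - 1
  · have h1 : {k : ZMod (2 ^ 2) | k ^ 2 = 1}.ncard = 2 := by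
      rw [Set.ncard_eq_toFinset_card']
      decide
    have e1 := ncard_card_eq_prime_sq (C := (ZMod p)ˣ) Nat.prime_two (by rwa [card_units_zmod])
    have e2 := ncard_card_eq_prime_sq_swap_fixed (C := (ZMod p)ˣ) Nat.prime_two
      (by rwa [card_units_zmod])
    rw [h1] at e2
    rw [if_neg fun h => h.2 hd4] at h
    rw [← h4] at e1 e2
    rw [e1, e2] at h
    rw [divInd, if_pos hd4]
    have : numSubgroupClasses 4 (GL (Fin 2) (ZMod p)) = 5 := by omega
    rw [this]; norm_num
  · have e1 := congrArg Set.ncard (setOf_card_eq_prime_sq_of_not_dvd (C := (ZMod p)ˣ) Nat.prime_two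
      (by rwa [card_units_zmod]) (by rwa [card_units_zmod]))
    have e2 := ncard_swap_fixed_prime_sq_of_not_dvd (p := p) Nat.prime_two hd hd4
    -- For odd p this always holds, so when 4 ∤ p - 1 a nonsplit class appears beside the single
    -- split class, that of the 2-torsion.
    have h2 : 4 ∣ p ^ 2 - 1 := by
      rw [Nat.sq_sub_one_eq]
      refine mul_dvd_mul (c := 2) (a := 2) ?_ hd
      have hp1 : 1 ≤ p := (Fact.out : p.Prime).one_le
      omega
    rw [Set.ncard_singleton] at e1
    rw [← h4] at e1 e2
    rw [e1, e2, if_pos ⟨h2, hd4⟩] at h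
    rw [divInd, if_neg hd4]
    have : numSubgroupClasses 4 (GL (Fin 2) (ZMod p)) = 2 := by omega
    rw [this]; norm_num

theorem numSubgroupClasses_prime_sq {q : ℕ} (hq : q.Prime) (hqp : q ≠ p) (hq2 : 2 < q) :
    (numSubgroupClasses (q ^ 2) (GL (Fin 2) (ZMod p)) : ℚ) =
      divInd (p - 1) q + ((q : ℚ) ^ 2 + q + 2) / 2 * divInd (p - 1) (q ^ 2) +
        divInd (p + 1) (q ^ 2) := by
  classical
  have hp1 : 1 ≤ p := (Fact.out : p.Prime).one_le
  have hqq : q ∣ q ^ 2 := dvd_pow_self q two_ne_zero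
  have h := two_mul_numSubgroupClasses (p := p) (m := q ^ 2) (by
    rw [Nat.cast_pow]
    exact pow_ne_zero _ (ZMod.natCast_prime_ne_zero hq hqp))
  rw [ncard_nonabelianClasses_eq_zero fun H => Subgroup.PairwiseCommute.of_card_prime_sq hq] at h
  by_cases hd : q ∣ p - 1
  · have hnd := Nat.Prime.not_dvd_add_one_of_dvd_sub_one hq2 hp1 hd
    rw [divInd, divInd, divInd, if_pos hd, if_neg (c := q ^ 2 ∣ p + 1) fun h => hnd (hqq.trans h)]
    by_cases hd2 : q ^ 2 ∣ p - 1
    · rw [if_neg fun h => h.2 hd2, ncard_card_eq_prime_sq hq (by rwa [card_units_zmod]),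
        ncard_card_eq_prime_sq_swap_fixed hq (by rwa [card_units_zmod]),
        ncard_sq_eq_one_of_prime_sq hq hq2.ne'] at h
      rw [if_pos hd2]
      have h' : (2 : ℚ) * numSubgroupClasses (q ^ 2) (GL (Fin 2) (ZMod p)) =
          q ^ 2 + q + 1 + (2 + 1) := by
        exact_mod_cast h
      linarith
    · have hn : ¬ (q ^ 2 ∣ p ^ 2 - 1 ∧ ¬ q ^ 2 ∣ p - 1) := by
        rintro ⟨h1, -⟩
        rw [Nat.sq_sub_one_eq] at h1
        -- An odd q divides at most one of p - 1 and p + 1, so q² dividing their product must divide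
        -- one factor.
        have hcop : Nat.Coprime (q ^ 2) (p + 1) :=
          Nat.Coprime.pow_left _ ((Nat.Prime.coprime_iff_not_dvd hq).2 hnd)
        exact hd2 (hcop.dvd_of_dvd_mul_left h1)
      rw [ncard_swap_fixed_prime_sq_of_not_dvd hq hd hd2, if_neg hn,
        setOf_card_eq_prime_sq_of_not_dvd hq (by rwa [card_units_zmod]) (by rwa [card_units_zmod]),
        Set.ncard_singleton] at h
      rw [if_neg hd2]
      have : numSubgroupClasses (q ^ 2) (GL (Fin 2) (ZMod p)) = 1 := by omega
      rw [this]; norm_num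
  · have hd2 : ¬ q ^ 2 ∣ p - 1 := fun h => hd (hqq.trans h)
    have he : {B : Subgroup ((ZMod p)ˣ × (ZMod p)ˣ) | Nat.card B = q ^ 2} = ∅ :=
      setOf_card_eq_of_not_dvd hq hqq (by rwa [card_units_zmod])
    have hiff : (q ^ 2 ∣ p ^ 2 - 1 ∧ ¬ q ^ 2 ∣ p - 1) ↔ q ^ 2 ∣ p + 1 := by
      rw [Nat.sq_sub_one_eq, and_iff_left hd2]
      have hcop : Nat.Coprime (q ^ 2) (p - 1) :=
        Nat.Coprime.pow_left _ ((Nat.Prime.coprime_iff_not_dvd hq).2 hd)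
      exact ⟨hcop.dvd_of_dvd_mul_right, fun h => h.mul_right _⟩
    rw [ncard_swap_fixed_eq_zero he, he, Set.ncard_empty] at h
    simp only [hiff] at h
    rw [divInd, divInd, divInd, if_neg hd, if_neg hd2]
    split_ifs at h ⊢
    · have : numSubgroupClasses (q ^ 2) (GL (Fin 2) (ZMod p)) = 1 := by omega
      rw [this]; norm_num
    · have : numSubgroupClasses (q ^ 2) (GL (Fin 2) (ZMod p)) = 0 := by omega
      rw [this]; norm_num

theorem numSubgroupClasses_two_mul (hp : p ≠ 2) {r : ℕ} (hr : r.Prime) (hrp : r ≠ p)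
    (hr2 : r ≠ 2) :
    (numSubgroupClasses (2 * r) (GL (Fin 2) (ZMod p)) : ℚ) =
      (3 * (r : ℚ) + 7) / 2 * divInd (p - 1) r + 2 * divInd (p + 1) r := by
  classical
  have hp1 : 1 ≤ p := (Fact.out : p.Prime).one_le
  have hr3 : 2 < r := lt_of_le_of_ne hr.two_le (Ne.symm hr2)
  have h2p := two_dvd_sub_one hp
  have hcop : Nat.Coprime 2 r := (Nat.coprime_primes Nat.prime_two hr).2 hr2.symm
  have h2 := ZMod.two_ne_zero_of_ne hp
  have hr0 := ZMod.natCast_prime_ne_zero hr hrp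
  have h := two_mul_numSubgroupClasses (p := p) (m := 2 * r) (by
    rw [Nat.cast_mul]
    exact mul_ne_zero (by exact_mod_cast h2) hr0)
  rw [ncard_nonabelianClasses_two_mul h2 hr hr2 hr0] at h
  by_cases hd : r ∣ p - 1
  · have hd' : 2 * r ∣ p - 1 := hcop.mul_dvd_of_dvd_of_dvd h2p hd
    have h1 : {k : ZMod 2 | k ^ 2 = 1}.ncard = 1 := by
      rw [Set.ncard_eq_toFinset_card']
      decide
    have hd3 : r ∣ p ^ 2 - 1 := by
      rw [Nat.sq_sub_one_eq]
      exact hd.mul_left _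
    rw [if_neg fun h => h.2 hd', if_pos hd3,
      ncard_card_eq_prime_mul Nat.prime_two hr hr2.symm (by rwa [card_units_zmod]),
      ncard_card_eq_swap_fixed_of_squarefree
        ((Nat.squarefree_mul hcop).2 ⟨Nat.prime_two.squarefree, hr.squarefree⟩)
        (by rwa [card_units_zmod]), ncard_sq_eq_one_mul hcop, h1,
      ncard_sq_eq_one_of_prime hr hr2] at h
    rw [divInd, divInd, if_pos hd, if_neg (Nat.Prime.not_dvd_add_one_of_dvd_sub_one hr3 hp1 hd)]
    -- The summands are: all torus subgroups, swap-invariant ones, no nonsplit class, and twice the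
    -- one dihedral class.
    have h' : (2 : ℚ) * numSubgroupClasses (2 * r) (GL (Fin 2) (ZMod p)) =
        (2 + 1) * (r + 1) + 1 * 2 + 2 * 0 + 2 * 1 := by
      exact_mod_cast h
    linarith
  · have he : {B : Subgroup ((ZMod p)ˣ × (ZMod p)ˣ) | Nat.card B = 2 * r} = ∅ :=
      setOf_card_eq_of_not_dvd hr (Dvd.intro_left _ rfl) (by rwa [card_units_zmod])
    have hiff1 : r ∣ p ^ 2 - 1 ↔ r ∣ p + 1 := by
      rw [Nat.sq_sub_one_eq, hr.dvd_mul]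
      tauto
    have hiff : (2 * r ∣ p ^ 2 - 1 ∧ ¬ 2 * r ∣ p - 1) ↔ r ∣ p + 1 := by
      rw [and_iff_left fun h => hd ((Dvd.intro_left _ rfl).trans h), ← hiff1]
      refine ⟨(Dvd.intro_left _ rfl).trans, fun h => hcop.mul_dvd_of_dvd_of_dvd ?_ h⟩
      rw [Nat.sq_sub_one_eq]
      exact h2p.mul_left _
    rw [ncard_swap_fixed_eq_zero he, he, Set.ncard_empty] at h
    simp only [hiff, hiff1] at h
    rw [divInd, divInd, if_neg hd]
    split_ifs at h ⊢
    · have : numSubgroupClasses (2 * r) (GL (Fin 2) (ZMod p)) = 2 := by omega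
      rw [this]; norm_num
    · have : numSubgroupClasses (2 * r) (GL (Fin 2) (ZMod p)) = 0 := by omega
      rw [this]; norm_num

theorem pairwiseCommute_of_card_odd_prime_mul {q r : ℕ} (hq : q.Prime) (hr : r.Prime)
    (hqp : q ≠ p) (hrp : r ≠ p) (hq2 : 2 < q) (hqr : q < r) {H : Subgroup (GL (Fin 2) (ZMod p))}
    (hH : Nat.card H = q * r) : H.PairwiseCommute := by
  -- The commutation argument divides by 2. For p = 2 the whole group has order 6, too small to
  -- contain a subgroup of order qr.
  by_cases hp : p = 2
  · subst hp
    exfalso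
    have h1 : Nat.card (GL (Fin 2) (ZMod 2)) = 6 := by
      rw [Matrix.card_GL_field]
      simp [Fin.prod_univ_two]
    have h2 := Nat.le_of_dvd (by rw [h1]; norm_num) H.card_subgroup_dvd_card
    rw [h1, hH] at h2
    nlinarith
  · exact commute_of_card_odd_prime_mul hp hq hr hqp hrp hq2 hqr hH

theorem numSubgroupClasses_odd_prime_mul {q r : ℕ} (hq : q.Prime) (hr : r.Prime)
    (hqp : q ≠ p) (hrp : r ≠ p) (hq2 : 2 < q) (hqr : q < r) :
    (numSubgroupClasses (q * r) (GL (Fin 2) (ZMod p)) : ℚ) =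
      ((q : ℚ) * r + q + r + 5) / 2 * divInd (p - 1) (q * r) +
        divInd (p ^ 2 - 1) (q * r) * (1 - divInd (p - 1) (q * r)) := by
  classical
  have hcop : Nat.Coprime q r := (Nat.coprime_primes hq hr).2 hqr.ne
  have h := two_mul_numSubgroupClasses (p := p) (m := q * r) (by
    rw [Nat.cast_mul]
    exact mul_ne_zero (ZMod.natCast_prime_ne_zero hq hqp) (ZMod.natCast_prime_ne_zero hr hrp))
  rw [ncard_nonabelianClasses_eq_zero
    fun H => pairwiseCommute_of_card_odd_prime_mul hq hr hqp hrp hq2 hqr] at h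
  by_cases hd : q * r ∣ p - 1
  · rw [if_neg fun h => h.2 hd,
      ncard_card_eq_prime_mul hq hr hqr.ne (by rwa [card_units_zmod]),
      ncard_card_eq_swap_fixed_of_squarefree
        ((Nat.squarefree_mul hcop).2 ⟨hq.squarefree, hr.squarefree⟩)
        (by rwa [card_units_zmod]), ncard_sq_eq_one_mul hcop,
      ncard_sq_eq_one_of_prime hq hq2.ne',
      ncard_sq_eq_one_of_prime hr (hq2.trans hqr).ne'] at h
    rw [divInd, divInd, if_pos hd]
    have h' : (2 : ℚ) * numSubgroupClasses (q * r) (GL (Fin 2) (ZMod p)) =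
        (q + 1) * (r + 1) + 2 * 2 + 2 * 0 + 2 * 0 := by
      exact_mod_cast h
    linarith
  · have he : {B : Subgroup ((ZMod p)ˣ × (ZMod p)ˣ) | Nat.card B = q * r} = ∅ := by
      by_cases hdq : q ∣ p - 1
      · have hdr : ¬ r ∣ p - 1 := fun hdr => hd (hcop.mul_dvd_of_dvd_of_dvd hdq hdr)
        exact setOf_card_eq_of_not_dvd hr (Dvd.intro_left _ rfl) (by rwa [card_units_zmod])
      · exact setOf_card_eq_of_not_dvd hq (Dvd.intro _ rfl) (by rwa [card_units_zmod])
    rw [ncard_swap_fixed_eq_zero he, he, Set.ncard_empty] at h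
    simp only [and_iff_left hd] at h
    rw [divInd, divInd, if_neg hd]
    split_ifs at h ⊢
    · have : numSubgroupClasses (q * r) (GL (Fin 2) (ZMod p)) = 1 := by omega
      rw [this]; norm_num
    · have : numSubgroupClasses (q * r) (GL (Fin 2) (ZMod p)) = 0 := by omega
      rw [this]; norm_num

end Arithmetic

theorem mainTheorem6 (p : ℕ) [Fact p.Prime] :
    -- order `q`
    (p ≠ 2 → numSubgroupClasses 2 (Matrix.GeneralLinearGroup (Fin 2) (ZMod p)) = 2) ∧
    (∀ q : ℕ, q.Prime → q ≠ p → 2 < q →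
      (numSubgroupClasses q (Matrix.GeneralLinearGroup (Fin 2) (ZMod p)) : ℚ) =
        ((q : ℚ) + 3) / 2 * divInd (p - 1) q + divInd (p + 1) q) ∧
    -- order `q ^ 2`
    (p ≠ 2 →
      (numSubgroupClasses 4 (Matrix.GeneralLinearGroup (Fin 2) (ZMod p)) : ℚ) =
        2 + 3 * divInd (p - 1) 4) ∧
    (∀ q : ℕ, q.Prime → q ≠ p → 2 < q →
      (numSubgroupClasses (q ^ 2) (Matrix.GeneralLinearGroup (Fin 2) (ZMod p)) : ℚ) =
        divInd (p - 1) q + ((q : ℚ) ^ 2 + q + 2) / 2 * divInd (p - 1) (q ^ 2) +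
          divInd (p + 1) (q ^ 2)) ∧
    -- order `q * r`
    (p ≠ 2 → ∀ r : ℕ, r.Prime → r ≠ p → r ≠ 2 →
      (numSubgroupClasses (2 * r) (Matrix.GeneralLinearGroup (Fin 2) (ZMod p)) : ℚ) =
        (3 * (r : ℚ) + 7) / 2 * divInd (p - 1) r + 2 * divInd (p + 1) r) ∧
    (∀ q r : ℕ, q.Prime → r.Prime → q ≠ p → r ≠ p → 2 < q → q < r →
      (numSubgroupClasses (q * r) (Matrix.GeneralLinearGroup (Fin 2) (ZMod p)) : ℚ) =
        ((q : ℚ) * r + q + r + 5) / 2 * divInd (p - 1) (q * r) +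
          divInd (p ^ 2 - 1) (q * r) * (1 - divInd (p - 1) (q * r))) :=
  ⟨numSubgroupClasses_two, fun _ hq hqp hq2 => numSubgroupClasses_prime hq hqp hq2,
    numSubgroupClasses_four, fun _ hq hqp hq2 => numSubgroupClasses_prime_sq hq hqp hq2,
    fun hp _ hr hrp hr2 => numSubgroupClasses_two_mul hp hr hrp hr2,
    fun _ _ hq hr hqp hrp hq2 hqr => numSubgroupClasses_odd_prime_mul hq hr hqp hrp hq2 hqr⟩
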